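/- Let $G=(V,E)$ be a cactus, i.e. a finite connected multigraph (parallel edges allowed, no loops) in which every edge lies in a unique cycle. Let $L\subseteq\binom V2$ be a set of links with costs $c\in\mathbb{R}^L_{\ge 0}$, treated as disjoint from $E$, and let $r\in V$ be a fixed center. A set $F\subseteq L$ is a *CacAP solution* if $(V,E\cup F)$ is $3$-edge-connected; assume that the instance has a solution. For $C\subseteq V$ let $\delta_E(C)$ and $\delta_L(C)$ be the edges, respectively links, with precisely one endpoint in $C$, and let $$\mathcal{C}_G=\{C\subseteq V\setminus\{r\} : |\delta_E(C)|=2\}.$$ A link is a *cross-link* if there is no connected component of $G-r$ with vertex set $W$ such that both endpoints of the link lie in $W\cup\{r\}$; let $L_{\mathrm{cross}}$ be the set of cross-links. Let $\vec L$ contain the two directed links $(u,v)$ and $(v,u)$, each of cost $c_{\{u,v\}}$, for every $\{u,v\}\in L$; a directed link $(u,v)$ enters $C$ if $u\notin C$ and $v\in C$. The dual of the bidirected cut LP is $$\max\Big\{\sum_{C\in\mathcal{C}_G}y_C \;:\; \sum_{C\in\mathcal{C}_G:\ \ell\text{ enters }C}y_C\le c_\ell\ \ \forall \ell\in\vec L,\quad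 y\in\mathbb{R}^{\mathcal{C}_G}_{\ge 0}\Big\}.$$ A feasible $y$ is *minimal* if for all $\varepsilon>0$ and all $C_1\subsetneq C_2$ in $\mathcal{C}_G$ the point $y-\varepsilon\chi^{\{C_2\}}+\varepsilon\chi^{\{C_1\}}$ is not feasible. Its support is *laminar* if any two sets $A,B\in\mathcal{C}_G$ with $y_A,y_B\neq 0$ are disjoint or comparable by inclusion. Then the dual LP has an optimal solution that is minimal and has laminar support. Moreover, there is an algorithm which, given $G$, $L$, $c$, $r$ and a set $R\subseteq L_{\mathrm{cross}}$ of cross-links, computes a set $F\subseteq L$ such that 1. $R\cup F$ is a CacAP solution, and 2. for every optimal dual solution $y^*$ that is minimal and has laminar support, $$c(F)\;\le\;\sum_{C\in\mathcal{C}_G:\ \delta_L(C)\cap R=\emptyset}y^*_C .$$ The algorithm runs in strongly polynomial time: it is a program for a random access machine whose unit-cost operations are additions, subtractions and comparisons of natural numbers and of real numbers, indirect memory access, and branching, and the number of its steps is bounded by a polynomial in $|V|+|E|+|L|$. -/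

import Mathlib

/-! ### Multigraphs, cuts, cacti -/

/-- A multigraph on the vertex set `V` whose edges are indexed by `E` (parallel edges are allowed).
The edge `e` joins `fst e` and `snd e`; it is undirected, the order of its endpoints plays no
role in any of the notions below. -/
structure Multigraph (V E : Type*) where
  fst : E → V
  snd : E → V

namespace Multigraph

variable {V E L : Type*}

/-- The edge `e` joins `u` and `v`. -/
def Joins (G : Multigraph V E) (e : E) (u v : V) : Prop :=
  (G.fst e = u ∧ G.snd e = v) ∨ (G.fst e = v ∧ G.snd e = u)

/-- The simple graph of adjacency between distinct vertices. -/
def toSimple (G : Multigraph V E) : SimpleGraph V :=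
  SimpleGraph.fromRel fun u v => ∃ e, G.Joins e u v

open Classical in
/-- `δ(C)`: the edges with precisely one endpoint in `C`. -/
noncomputable def boundary [Fintype E] (G : Multigraph V E) (C : Finset V) : Finset E :=
  Finset.univ.filter fun e => Xor (G.fst e ∈ C) (G.snd e ∈ C)

/-- `D` is the edge set of a cycle: there are `l + 2` distinct vertices `v 0, …, v (l + 1)` and
distinct edges `e 0, …, e (l + 1)` such that `e i` joins `v i` and `v (i + 1)`, indices being taken
modulo `l + 2`. Two parallel edges form a cycle of length two. -/
def IsCycle (G : Multigraph V E) (D : Set E) : Prop :=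
  ∃ (l : ℕ) (v : Fin (l + 2) → V) (e : Fin (l + 2) → E),
    Function.Injective v ∧ Function.Injective e ∧
    (∀ i, G.Joins (e i) (v i) (v (i + 1))) ∧ D = Set.range e

/-- A cactus: a connected graph in which every edge lies in a unique cycle. (Loops are thereby
excluded, since a loop lies in no cycle in the above sense.) -/
def IsCactus (G : Multigraph V E) : Prop :=
  G.toSimple.Connected ∧ ∀ e : E, ∃! D : Set E, G.IsCycle D ∧ e ∈ D

/-- `k`-edge-connectivity: every cut `∅ ≠ S ≠ V` has at least `k` edges. -/
def EdgeConnected [Fintype V] [Fintype E] (G : Multigraph V E) (k : ℕ) : Prop :=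
  ∀ S : Finset V, S.Nonempty → S ≠ Finset.univ → k ≤ (G.boundary S).card

/-- The graph `(V, E ∪ F)` obtained from `G` by adding the links in `F`, where links and edges are
always treated as disjoint. -/
def augment (G : Multigraph V E) (H : Multigraph V L) (F : Finset L) :
    Multigraph V (E ⊕ {ℓ // ℓ ∈ F}) where
  fst := Sum.elim G.fst fun ℓ => H.fst ℓ
  snd := Sum.elim G.snd fun ℓ => H.snd ℓ

/-- The vertex set of an `r`-principal subcactus: `W ∪ {r}`, where `W` is the vertex set of a
connected component of `G - r`. -/
def IsPrincipal (G : Multigraph V E) (r : V) (U : Set V) : Prop :=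
  ∃ K : (G.toSimple.induce {v | v ≠ r}).ConnectedComponent,
    U = insert r (Subtype.val '' K.supp)

end Multigraph

/-! ### Weighted cactus augmentation -/

/-- A weighted instance of the cactus augmentation problem with vertices `V`, edges `E`, links `L`,
and a vertex `root` chosen as center. The links form a set of two-element subsets of `V`. -/
structure CacAP (V E L : Type*) where
  graph : Multigraph V E
  links : Multigraph V L
  cost : L → ℝ
  root : V
  isCactus : graph.IsCactus
  links_ne : ∀ ℓ, links.fst ℓ ≠ links.snd ℓ
  links_inj : ∀ ℓ ℓ', links.Joins ℓ (links.fst ℓ') (links.snd ℓ') → ℓ = ℓ'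
  cost_nonneg : ∀ ℓ, 0 ≤ cost ℓ

namespace CacAP

variable {V E L : Type*} [Fintype V] [Fintype E] [Fintype L] (I : CacAP V E L)

/-- `F` is a solution: `(V, E ∪ F)` is `3`-edge-connected. -/
def IsSolution (F : Finset L) : Prop :=
  (I.graph.augment I.links F).EdgeConnected 3

/-- The instance is feasible: it has a solution. -/
def Feasible : Prop := ∃ F, I.IsSolution F

open Classical in
/-- The cross-links: the links whose endpoints do not lie in a common principal subcactus. -/
noncomputable def crossLinks : Finset L :=
  Finset.univ.filter fun ℓ =>
    ¬ ∃ U, I.graph.IsPrincipal I.root U ∧ I.links.fst ℓ ∈ U ∧ I.links.snd ℓ ∈ U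

open Classical in
/-- The family of `2`-cuts `C ⊆ V \ {root}`, `|δ_E(C)| = 2`. -/
noncomputable def twoCuts : Finset (Finset V) :=
  Finset.univ.filter fun C => I.root ∉ C ∧ (I.graph.boundary C).card = 2

open Classical in
/-- The `2`-cuts that are not crossed by any link in `R`. -/
noncomputable def uncrossedCuts (R : Finset L) : Finset (Finset V) :=
  I.twoCuts.filter fun C => I.links.boundary C ∩ R = ∅

open Classical in
/-- Feasibility for the dual of the bidirected cut LP: `y` is nonnegative on the `2`-cuts, and for
each of the two directed links `(u, v)` arising from a link `ℓ`, the total value of the `2`-cuts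
that `(u, v)` enters is at most the cost of `ℓ`. Only the values of `y` on `2`-cuts matter. -/
def DualFeasible (y : Finset V → ℝ) : Prop :=
  (∀ C ∈ I.twoCuts, 0 ≤ y C) ∧
  ∀ ℓ u v, I.links.Joins ℓ u v →
    ∑ C ∈ I.twoCuts with u ∉ C ∧ v ∈ C, y C ≤ I.cost ℓ

/-- Optimality for the dual of the bidirected cut LP. -/
def DualOptimal (y : Finset V → ℝ) : Prop :=
  I.DualFeasible y ∧
  ∀ y', I.DualFeasible y' → ∑ C ∈ I.twoCuts, y' C ≤ ∑ C ∈ I.twoCuts, y C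

open Classical in
/-- Minimality: no dual weight can be moved from a `2`-cut to a strictly smaller one while
maintaining feasibility. -/
def DualMinimal (y : Finset V → ℝ) : Prop :=
  ∀ ε > 0, ∀ C₁ ∈ I.twoCuts, ∀ C₂ ∈ I.twoCuts, C₁ ⊂ C₂ →
    ¬ I.DualFeasible fun C =>
      y C - (if C = C₂ then ε else 0) + (if C = C₁ then ε else 0)

/-- The support of `y` is laminar: any two of its sets are disjoint or comparable. -/
def LaminarSupport (y : Finset V → ℝ) : Prop :=
  ∀ A ∈ I.twoCuts, ∀ B ∈ I.twoCuts, y A ≠ 0 → y B ≠ 0 →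
    Disjoint A B ∨ A ⊆ B ∨ B ⊆ A

/-- `y` is an optimal dual solution that is minimal and has laminar support. -/
def IsMinimalLaminarOptimum (y : Finset V → ℝ) : Prop :=
  I.DualOptimal y ∧ I.DualMinimal y ∧ I.LaminarSupport y

end CacAP

/-! ### The model of computation

Structured programs for a random access machine. The memory consists of arrays of natural numbers
(for the combinatorial data) and arrays of real numbers (for the costs). The only operations are
addition, subtraction (truncated at zero for natural numbers), comparison, indirect access to the
arrays, branching and while-loops, each at unit cost. A real number can influence the natural
numbers and the control flow only through comparisons. As there is no multiplication, the numbers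
that occur in a computation with `t` steps have encoding length `O(t)` plus that of the input, so on
rational costs a polynomial bound on the number of steps is a polynomial bound on the running
time of a Turing machine. -/

namespace RAM

/-- A memory content: the cells of the arrays of natural numbers and of real numbers. -/
structure State where
  nat : ℕ → ℕ → ℕ
  real : ℕ → ℕ → ℝ

inductive NatExpr
  | const (c : ℕ)
  | read (a : ℕ) (i : NatExpr)
  | add (e f : NatExpr)
  | sub (e f : NatExpr)

inductive RealExpr
  | zero
  | read (a : ℕ) (i : NatExpr)
  | add (e f : RealExpr)
  | sub (e f : RealExpr)

inductive Test
  | natLe (e f : NatExpr)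
  | realLe (e f : RealExpr)
  | not (b : Test)
  | and (b b' : Test)

inductive Prog
  | skip
  | setNat (a : ℕ) (i e : NatExpr)
  | setReal (a : ℕ) (i : NatExpr) (e : RealExpr)
  | seq (P Q : Prog)
  | ite (b : Test) (P Q : Prog)
  | loop (b : Test) (P : Prog)

def NatExpr.eval (s : State) : NatExpr → ℕ
  | .const c => c
  | .read a i => s.nat a (i.eval s)
  | .add e f => e.eval s + f.eval s
  | .sub e f => e.eval s - f.eval s

noncomputable def RealExpr.eval (s : State) : RealExpr → ℝ
  | .zero => 0
  | .read a i => s.real a (i.eval s)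
  | .add e f => e.eval s + f.eval s
  | .sub e f => e.eval s - f.eval s

def Test.Holds (s : State) : Test → Prop
  | .natLe e f => e.eval s ≤ f.eval s
  | .realLe e f => e.eval s ≤ f.eval s
  | .not b => ¬ b.Holds s
  | .and b b' => b.Holds s ∧ b'.Holds s

def State.setNat (s : State) (a i x : ℕ) : State where
  nat := Function.update s.nat a (Function.update (s.nat a) i x)
  real := s.real

noncomputable def State.setReal (s : State) (a i : ℕ) (x : ℝ) : State where
  nat := s.nat
  real := Function.update s.real a (Function.update (s.real a) i x)

/-- `P.Run s t s'`: started in the memory content `s`, the program `P` halts after `t` steps with the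
memory content `s'`. A step is the execution of an assignment or the evaluation of a test; the
expressions in it have a fixed size, which depends on the program only. -/
inductive Prog.Run : Prog → State → ℕ → State → Prop
  | skip (s : State) : Run .skip s 1 s
  | setNat (a : ℕ) (i e : NatExpr) (s : State) :
      Run (.setNat a i e) s 1 (s.setNat a (i.eval s) (e.eval s))
  | setReal (a : ℕ) (i : NatExpr) (e : RealExpr) (s : State) :
      Run (.setReal a i e) s 1 (s.setReal a (i.eval s) (e.eval s))
  | seq {P Q : Prog} {s s' s'' : State} {t t' : ℕ} :
      Run P s t s' → Run Q s' t' s'' → Run (.seq P Q) s (t + t') s''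
  | ite_true {b : Test} {P Q : Prog} {s s' : State} {t : ℕ} :
      b.Holds s → Run P s t s' → Run (.ite b P Q) s (t + 1) s'
  | ite_false {b : Test} {P Q : Prog} {s s' : State} {t : ℕ} :
      ¬ b.Holds s → Run Q s t s' → Run (.ite b P Q) s (t + 1) s'
  | loop_true {b : Test} {P : Prog} {s s' s'' : State} {t t' : ℕ} :
      b.Holds s → Run P s t s' → Run (.loop b P) s' t' s'' → Run (.loop b P) s (t + t' + 1) s''
  | loop_false {b : Test} {P : Prog} {s : State} :
      ¬ b.Holds s → Run (.loop b P) s 1 s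

/-- The array `i ↦ f i` for `i < n`, padded with zeros. -/
def pad {α : Type*} [Zero α] {n : ℕ} (f : Fin n → α) (i : ℕ) : α :=
  if h : i < n then f ⟨i, h⟩ else 0

end RAM

/-- The initial memory content for an instance with vertices `0, …, n - 1`, edges `0, …, m - 1` and
links `0, …, k - 1`, together with a set `R` of links. Array `0` holds `n`, `m`, `k` and the root;
arrays `1` and `2` hold the endpoints of the edges, arrays `3` and `4` those of the links, array `5`
the characteristic vector of `R`; the real array `0` holds the costs. All other cells are zero. -/
def CacAP.input {n m k : ℕ} (I : CacAP (Fin n) (Fin m) (Fin k)) (R : Finset (Fin k)) :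
    RAM.State where
  nat a := match a with
    | 0 => RAM.pad ![n, m, k, (I.root : ℕ)]
    | 1 => RAM.pad fun e => (I.graph.fst e : ℕ)
    | 2 => RAM.pad fun e => (I.graph.snd e : ℕ)
    | 3 => RAM.pad fun ℓ => (I.links.fst ℓ : ℕ)
    | 4 => RAM.pad fun ℓ => (I.links.snd ℓ : ℕ)
    | 5 => RAM.pad fun ℓ => if ℓ ∈ R then 1 else 0
    | _ => fun _ => 0
  real a := match a with
    | 0 => RAM.pad I.cost
    | _ => fun _ => 0

/-- The set of links that a final memory content represents: those marked by a nonzero entry in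
array `6`. -/
def RAM.State.output (s : RAM.State) (k : ℕ) : Finset (Fin k) :=
  Finset.univ.filter fun ℓ => s.nat 6 ℓ ≠ 0

/-! In a cactus every proper nonempty cut has at least two edges. By submodularity of the cut
function, the 2-cuts avoiding the root are therefore an intersecting family: when two of them meet,
their intersection and union are again members. The same holds for the family `U` of 2-cuts not
crossed by `R`. Since a solution is exactly a set of links crossing every 2-cut that avoids the
root, it remains to cover `U`, which is done with directed links.

Covering an intersecting family by directed links is solved exactly by a primal-dual greedy method.
Sets are processed by increasing size. The dual variable of a set not yet entered is raised until
some entering link becomes tight, and that link is chosen. A selection in reverse order then keeps a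
link only if no link already kept enters its set. Uncrossing shows that the kept links enter every
member of `U` (`IsGreedy.Selects.cover`) and enter each raised set at most once
(`IsGreedy.Selects.eq_of_enters`). As they are tight, they cost at most the greedy dual value
(`IsGreedy.Selects.sum_cost_le`). For `R = ∅` weak duality makes the greedy dual optimal, and the
order of processing makes it minimal and laminar.

For general `R` the greedy dual on `U` must be compared with the restriction of an arbitrary minimal
laminar optimum `y`. By weak duality it suffices to find a cover of `U` costing at most the sum of
`y` over `U` (`IsMinimalLaminarOptimum.exists_cover`). Such a cover consists of directed links that
are tight for the restricted weights and enter each set of the support in `U` at most once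
(`exists_cover_of_laminar`). Optimality and minimality of `y` supply enough tight links. That they
stay tight after restriction depends on `R` consisting of cross-links: a 2-cut lies in one principal
subcactus, so no link of `R` has both ends in it, and `U` is closed under passing to smaller 2-cuts
(`mem_uncrossedCuts_of_subset`).

The running time needs an enumeration of the 2-cuts: each one is the set separated from the root by
two edges, so trying all pairs suffices (`exists_separated_eq`). -/

set_option linter.unusedSectionVars false

/-! ### Program logic: time bounds, frames and loop rules -/

namespace RAM

/-- A bound on the number of steps of a program whose loops run at most `N` times each. -/
def Prog.time (N : ℕ) : Prog → ℕ
  | .skip => 1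
  | .setNat _ _ _ => 1
  | .setReal _ _ _ => 1
  | .seq P Q => P.time N + Q.time N
  | .ite _ P Q => P.time N + Q.time N + 1
  | .loop _ P => N * (P.time N + 1) + 1

/-- Each constructor acts on the bound by a polynomial operation. The two branches of a conditional
are added instead of taking their maximum precisely so that this remains true. -/
theorem Prog.exists_polynomial_time (P : Prog) :
    ∃ p : Polynomial ℕ, ∀ N, P.time N = p.eval N := by
  induction P with
  | skip => exact ⟨1, fun N => by simp [Prog.time]⟩
  | setNat => exact ⟨1, fun N => by simp [Prog.time]⟩
  | setReal => exact ⟨1, fun N => by simp [Prog.time]⟩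
  | seq P Q hP hQ =>
    obtain ⟨p, hp⟩ := hP
    obtain ⟨q, hq⟩ := hQ
    exact ⟨p + q, fun N => by simp [Prog.time, hp, hq]⟩
  | ite b P Q hP hQ =>
    obtain ⟨p, hp⟩ := hP
    obtain ⟨q, hq⟩ := hQ
    exact ⟨p + q + 1, fun N => by simp [Prog.time, hp, hq]⟩
  | loop b P hP =>
    obtain ⟨p, hp⟩ := hP
    exact ⟨Polynomial.X * (p + 1) + 1, fun N => by simp [Prog.time, hp]⟩

/-- The program may write to the array `a` of natural numbers. -/
def Prog.writesNat : Prog → ℕ → Bool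
  | .skip, _ => false
  | .setNat a _ _, b => b == a
  | .setReal _ _ _, _ => false
  | .seq P Q, b => P.writesNat b || Q.writesNat b
  | .ite _ P Q, b => P.writesNat b || Q.writesNat b
  | .loop _ P, b => P.writesNat b

/-- The program may write to the array `a` of real numbers. -/
def Prog.writesReal : Prog → ℕ → Bool
  | .skip, _ => false
  | .setNat _ _ _, _ => false
  | .setReal a _ _, b => b == a
  | .seq P Q, b => P.writesReal b || Q.writesReal b
  | .ite _ P Q, b => P.writesReal b || Q.writesReal b
  | .loop _ P, b => P.writesReal b

/-- The memory contents `s` and `s'` agree on all arrays to which `P` does not write. -/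
structure Prog.Frame (P : Prog) (s s' : State) : Prop where
  nat : ∀ a, P.writesNat a = false → s'.nat a = s.nat a
  real : ∀ a, P.writesReal a = false → s'.real a = s.real a

@[simp] theorem State.setNat_nat_self (s : State) (a i x : ℕ) :
    (s.setNat a i x).nat a = Function.update (s.nat a) i x := by simp [State.setNat]

@[simp] theorem State.setNat_nat_of_ne (s : State) {a b : ℕ} (i x : ℕ) (h : b ≠ a) :
    (s.setNat a i x).nat b = s.nat b := by simp [State.setNat, h]

@[simp] theorem State.setNat_real (s : State) (a i x : ℕ) : (s.setNat a i x).real = s.real := rfl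

@[simp] theorem State.setReal_real_self (s : State) (a i : ℕ) (x : ℝ) :
    (s.setReal a i x).real a = Function.update (s.real a) i x := by simp [State.setReal]

@[simp] theorem State.setReal_real_of_ne (s : State) {a b : ℕ} (i : ℕ) (x : ℝ) (h : b ≠ a) :
    (s.setReal a i x).real b = s.real b := by simp [State.setReal, h]

@[simp] theorem State.setReal_nat (s : State) (a i : ℕ) (x : ℝ) :
    (s.setReal a i x).nat = s.nat := rfl

/-- Loop invariants need to mention only the arrays that a program changes. Everything else is
recovered from this syntactic check, which is decidable for concrete programs. -/
theorem Prog.Run.frame {P : Prog} {s s' : State} {t : ℕ} (h : P.Run s t s') : P.Frame s s' := by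
  induction h with
  | skip => exact ⟨fun _ _ => rfl, fun _ _ => rfl⟩
  | setNat a i e s =>
    refine ⟨fun b hb => ?_, fun _ _ => rfl⟩
    simp only [Prog.writesNat, beq_eq_false_iff_ne] at hb
    simp [hb]
  | setReal a i e s =>
    refine ⟨fun _ _ => rfl, fun b hb => ?_⟩
    simp only [Prog.writesReal, beq_eq_false_iff_ne] at hb
    simp [hb]
  | seq _ _ h₁ h₂ =>
    refine ⟨fun b hb => ?_, fun b hb => ?_⟩
    · simp only [Prog.writesNat, Bool.or_eq_false_iff] at hb
      rw [h₂.nat b hb.2, h₁.nat b hb.1]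
    · simp only [Prog.writesReal, Bool.or_eq_false_iff] at hb
      rw [h₂.real b hb.2, h₁.real b hb.1]
  | ite_true _ _ h₁ =>
    refine ⟨fun b hb => ?_, fun b hb => ?_⟩
    · simp only [Prog.writesNat, Bool.or_eq_false_iff] at hb
      rw [h₁.nat b hb.1]
    · simp only [Prog.writesReal, Bool.or_eq_false_iff] at hb
      rw [h₁.real b hb.1]
  | ite_false _ _ h₁ =>
    refine ⟨fun b hb => ?_, fun b hb => ?_⟩
    · simp only [Prog.writesNat, Bool.or_eq_false_iff] at hb
      rw [h₁.nat b hb.2]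
    · simp only [Prog.writesReal, Bool.or_eq_false_iff] at hb
      rw [h₁.real b hb.2]
  | loop_true _ _ _ h₁ h₂ =>
    refine ⟨fun b hb => ?_, fun b hb => ?_⟩
    · rw [h₂.nat b hb, h₁.nat b hb]
    · rw [h₂.real b hb, h₁.real b hb]
  | loop_false => exact ⟨fun _ _ => rfl, fun _ _ => rfl⟩

/-- Started in `s`, the program `P` halts within `P.time N` steps in a memory content
satisfying `Q`. -/
def Prog.Ok (N : ℕ) (P : Prog) (s : State) (Q : State → Prop) : Prop :=
  ∃ t s', P.Run s t s' ∧ t ≤ P.time N ∧ Q s'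

variable {N : ℕ} {P P' : Prog} {s : State} {Q Q' : State → Prop}

theorem Prog.Ok.mono' (h : P.Ok N s Q) (hQ : ∀ s', P.Frame s s' → Q s' → Q' s') :
    P.Ok N s Q' := by
  obtain ⟨t, s', h₁, h₂, h₃⟩ := h
  exact ⟨t, s', h₁, h₂, hQ s' h₁.frame h₃⟩

theorem ok_skip (h : Q s) : Prog.skip.Ok N s Q := ⟨1, s, .skip s, le_rfl, h⟩

theorem ok_setNat {a : ℕ} {i e : NatExpr} (h : Q (s.setNat a (i.eval s) (e.eval s))) :
    (Prog.setNat a i e).Ok N s Q := ⟨1, _, .setNat a i e s, le_rfl, h⟩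

theorem ok_setReal {a : ℕ} {i : NatExpr} {e : RealExpr}
    (h : Q (s.setReal a (i.eval s) (e.eval s))) :
    (Prog.setReal a i e).Ok N s Q := ⟨1, _, .setReal a i e s, le_rfl, h⟩

theorem ok_seq (h : P.Ok N s fun s' => P'.Ok N s' Q) : (Prog.seq P P').Ok N s Q := by
  obtain ⟨t, s', h₁, h₂, t', s'', h₃, h₄, h₅⟩ := h
  exact ⟨t + t', s'', .seq h₁ h₃, Nat.add_le_add h₂ h₄, h₅⟩

/-- Sequential composition, where the effect of the first program is known up to its frame. -/
theorem ok_seq' {Q₁ : State → Prop} (h : P.Ok N s Q₁)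
    (h' : ∀ s', P.Frame s s' → Q₁ s' → P'.Ok N s' Q) : (Prog.seq P P').Ok N s Q :=
  ok_seq (h.mono' h')

theorem ok_ite {b : Test} (h : b.Holds s → P.Ok N s Q) (h' : ¬ b.Holds s → P'.Ok N s Q) :
    (Prog.ite b P P').Ok N s Q := by
  by_cases hb : b.Holds s
  · obtain ⟨t, s', h₁, h₂, h₃⟩ := h hb
    exact ⟨t + 1, s', .ite_true hb h₁, by simp only [Prog.time]; omega, h₃⟩
  · obtain ⟨t, s', h₁, h₂, h₃⟩ := h' hb
    exact ⟨t + 1, s', .ite_false hb h₁, by simp only [Prog.time]; omega, h₃⟩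

/-- `for i in [0, b)`, the counter being the first cell of the array `a`. -/
def Prog.forTo (a : ℕ) (b : NatExpr) (P : Prog) : Prog :=
  .seq (.setNat a (.const 0) (.const 0))
    (.loop (.natLe (.add (.read a (.const 0)) (.const 1)) b)
      (.seq P (.setNat a (.const 0) (.add (.read a (.const 0)) (.const 1)))))

/-- Invariant rule for counted loops. The bound may be any expression whose value is constant on all
states in the frame of the loop. The invariant is required after the counter update, so that the
increment is accounted for. -/
theorem ok_forTo {a M : ℕ} {b : NatExpr} (Inv : ℕ → State → Prop) (hM : M ≤ N)
    (ha : P.writesNat a = false)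
    (hb : ∀ s', (Prog.forTo a b P).Frame s s' → b.eval s' = M)
    (h₀ : Inv 0 (s.setNat a 0 0))
    (hstep : ∀ i < M, ∀ s', (Prog.forTo a b P).Frame s s' → s'.nat a 0 = i → Inv i s' →
      P.Ok N s' fun s'' => Inv (i + 1) (s''.setNat a 0 (i + 1))) :
    (Prog.forTo a b P).Ok N s (Inv M) := by
  set B : Prog := .seq P (.setNat a (.const 0) (.add (.read a (.const 0)) (.const 1))) with hB
  have hframe : ∀ s', (Prog.forTo a b P).Frame s s' → ∀ s'', B.Frame s' s'' →
      (Prog.forTo a b P).Frame s s'' := by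
    intro s' h' s'' h''
    refine ⟨fun c hc => ?_, fun c hc => ?_⟩
    · have hc' := hc
      simp only [Prog.forTo, Prog.writesNat, Bool.or_eq_false_iff] at hc'
      rw [h''.nat c (by simp [hB, Prog.writesNat, hc'.2.1, hc'.2.2]), h'.nat c hc]
    · have hc' := hc
      simp only [Prog.forTo, Prog.writesReal, Bool.or_eq_false_iff] at hc'
      rw [h''.real c (by simp [hB, Prog.writesReal, hc'.2.1]), h'.real c hc]
  -- Induction on the number `j` of remaining iterations. The time is bounded by the actual number
  -- of iterations, which is replaced by `N` at the end.
  have main : ∀ j i, i + j = M → ∀ s', (Prog.forTo a b P).Frame s s' → s'.nat a 0 = i →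
      Inv i s' → ∃ t s'', (Prog.loop (.natLe (.add (.read a (.const 0)) (.const 1)) b) B).Run
        s' t s'' ∧ t ≤ j * (B.time N + 1) + 1 ∧ Inv M s'' := by
    intro j
    induction j with
    | zero =>
      intro i hi s' hf hc hI
      refine ⟨1, s', .loop_false ?_, by simp, by simpa [← hi] using hI⟩
      simp only [Test.Holds, NatExpr.eval, hc, hb s' hf]
      omega
    | succ j ih =>
      intro i hi s' hf hc hI
      obtain ⟨t, s₁, h₁, h₂, h₃⟩ := hstep i (by omega) s' hf hc hI
      have hc₁ : s₁.nat a 0 = i := by rw [h₁.frame.nat a ha, hc]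
      have hrun : B.Run s' (t + 1) (s₁.setNat a 0 (i + 1)) := by
        have := Prog.Run.seq h₁
          (.setNat a (.const 0) (.add (.read a (.const 0)) (.const 1)) s₁)
        simpa only [NatExpr.eval, hc₁] using this
      obtain ⟨t', s₂, h₄, h₅, h₆⟩ := ih (i + 1) (by omega) (s₁.setNat a 0 (i + 1))
        (hframe s' hf _ hrun.frame) (by simp) h₃
      refine ⟨t + 1 + t' + 1, s₂, .loop_true ?_ hrun h₄, ?_, h₆⟩
      · simp only [Test.Holds, NatExpr.eval, hc, hb s' hf]
        omega
      · have : B.time N = P.time N + 1 := by simp [hB, Prog.time]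
        rw [this] at h₅ ⊢
        rw [Nat.succ_mul]
        omega
  have hinit : (Prog.forTo a b P).Frame s (s.setNat a 0 0) := by
    refine ⟨fun c hc => ?_, fun _ _ => rfl⟩
    simp only [Prog.forTo, Prog.writesNat, Bool.or_eq_false_iff, beq_eq_false_iff_ne] at hc
    simp [hc.1]
  obtain ⟨t, s', h₁, h₂, h₃⟩ := main M 0 (by simp) (s.setNat a 0 0) hinit (by simp) h₀
  refine ⟨1 + t, s', .seq (.setNat a (.const 0) (.const 0) s) h₁, ?_, h₃⟩
  simp only [Prog.forTo, Prog.time]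
  have : M * (B.time N + 1) ≤ N * (B.time N + 1) := Nat.mul_le_mul_right _ hM
  simp only [hB, Prog.time] at this h₂ ⊢
  omega

/-- Equality of natural numbers. -/
def Test.natEq (e f : NatExpr) : Test := .and (.natLe e f) (.natLe f e)

@[simp] theorem Test.holds_natEq (e f : NatExpr) :
    (Test.natEq e f).Holds s ↔ e.eval s = f.eval s := by
  simp only [Test.natEq, Test.Holds]
  omega

/-- Set the first cell of the array `c` to `1` if the test `b` succeeds for some value of the
counter in `[0, e)`, and to `0` otherwise. -/
def Prog.anyTo (c a : ℕ) (e : NatExpr) (b : Test) : Prog :=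
  .seq (.setNat c (.const 0) (.const 0))
    (.forTo a e (.ite b (.setNat c (.const 0) (.const 1)) .skip))

theorem ok_anyTo {c a M : ℕ} {e : NatExpr} {b : Test} (p : ℕ → Prop) (hM : M ≤ N) (hca : c ≠ a)
    (he : ∀ s', (Prog.anyTo c a e b).Frame s s' → e.eval s' = M)
    (hp : ∀ i < M, ∀ s', (Prog.anyTo c a e b).Frame s s' → s'.nat a 0 = i →
      (b.Holds s' ↔ p i)) :
    (Prog.anyTo c a e b).Ok N s fun s' => s'.nat c 0 = 0 ↔ ∀ i < M, ¬ p i := by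
  have hfr : ∀ s', (Prog.forTo a e (.ite b (.setNat c (.const 0) (.const 1)) .skip)).Frame
      (s.setNat c 0 0) s' → (Prog.anyTo c a e b).Frame s s' := by
    intro s' h
    refine ⟨fun d hd => ?_, fun d hd => ?_⟩
    · have hd' := hd
      simp only [Prog.anyTo, Prog.writesNat, Bool.or_eq_false_iff, beq_eq_false_iff_ne] at hd'
      rw [h.nat d hd'.2]
      simp [hd'.1]
    · rw [h.real d (by simpa [Prog.anyTo, Prog.writesReal] using hd)]
      rfl
  refine ok_seq (ok_setNat ?_)
  refine ok_forTo (fun i s' => s'.nat c 0 = 0 ↔ ∀ j < i, ¬ p j) hM ?_ (fun s' h => he s' (hfr s' h))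
    (by simp [hca, NatExpr.eval]) ?_
  · simp [Prog.writesNat, hca.symm]
  · intro i hi s' hf hc hI
    have := hp i hi s' (hfr s' hf) hc
    refine ok_ite (fun hb => ok_setNat ?_) (fun hb => ok_skip ?_)
    · simp only [NatExpr.eval, ne_eq, hca, not_false_eq_true, State.setNat_nat_of_ne,
        State.setNat_nat_self, Function.update_self, one_ne_zero, false_iff, not_forall]
      exact ⟨i, by omega, by simpa using this.1 hb⟩
    · rw [this] at hb
      simp only [ne_eq, hca, not_false_eq_true, State.setNat_nat_of_ne, hI]
      constructor
      · intro h j hj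
        rcases Nat.lt_succ_iff_lt_or_eq.1 hj with h' | rfl
        exacts [h j h', hb]
      · intro h j hj
        exact h j (by omega)

end RAM

/-! ### Directed links and intersecting families -/

section Covering

variable {V D : Type*} [DecidableEq V]

/-- The family is intersecting: closed under intersection and union of sets that meet. -/
def IsIntersecting (U : Finset (Finset V)) : Prop :=
  ∀ A ∈ U, ∀ B ∈ U, (A ∩ B).Nonempty → A ∩ B ∈ U ∧ A ∪ B ∈ U

/-- The directed link `d` enters `C`. -/
def Enters (tail head : D → V) (d : D) (C : Finset V) : Prop := tail d ∉ C ∧ head d ∈ C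

instance (tail head : D → V) (d : D) (C : Finset V) : Decidable (Enters tail head d C) :=
  inferInstanceAs (Decidable (_ ∧ _))

variable {tail head : D → V}

theorem Enters.or_of_inter {d : D} {A B : Finset V} (h : Enters tail head d (A ∩ B)) :
    Enters tail head d A ∨ Enters tail head d B := by
  unfold Enters at *
  simp only [Finset.mem_inter] at h
  tauto

theorem Enters.or_of_union {d : D} {A B : Finset V} (h : Enters tail head d (A ∪ B)) :
    Enters tail head d A ∨ Enters tail head d B := by
  unfold Enters at *
  simp only [Finset.mem_union] at h
  tauto

/-- The total dual weight of the sets of `U` that `d` enters. -/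
def load (tail head : D → V) (U : Finset (Finset V)) (y : Finset V → ℝ) (d : D) : ℝ :=
  ∑ C ∈ U with Enters tail head d C, y C

/-- Weak duality: a cover costs at least as much as any feasible dual solution. -/
theorem sum_le_sum_cost_of_cover {ι : Type*} {U : Finset (Finset V)} {y : Finset V → ℝ}
    {cost : D → ℝ} (hy : ∀ C ∈ U, 0 ≤ y C) (hf : ∀ d, load tail head U y d ≤ cost d)
    (F : Finset ι) (f : ι → D) (hF : ∀ C ∈ U, ∃ i ∈ F, Enters tail head (f i) C) :
    ∑ C ∈ U, y C ≤ ∑ i ∈ F, cost (f i) := by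
  calc ∑ C ∈ U, y C ≤ ∑ C ∈ U, ∑ i ∈ F, if Enters tail head (f i) C then y C else 0 := by
        refine Finset.sum_le_sum fun C hC => ?_
        obtain ⟨i, hi, h⟩ := hF C hC
        have := Finset.single_le_sum
          (f := fun i => if Enters tail head (f i) C then y C else 0)
          (fun j _ => by split_ifs <;> simp [hy C hC]) hi
        simpa [h] using this
    _ = ∑ i ∈ F, load tail head U y (f i) := by
        rw [Finset.sum_comm]
        simp only [load, Finset.sum_filter]
    _ ≤ _ := Finset.sum_le_sum fun i _ => hf _

/-- A set of tight directed links that enters every set of positive dual weight at most once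
costs at most the dual value. -/
theorem sum_cost_le_sum_of_tight {U : Finset (Finset V)} {y : Finset V → ℝ}
    {cost : D → ℝ} (hy : ∀ C ∈ U, 0 ≤ y C) (F : Finset D)
    (ht : ∀ d ∈ F, cost d = load tail head U y d)
    (h₁ : ∀ C ∈ U, y C ≠ 0 → ∀ d ∈ F, ∀ d' ∈ F, Enters tail head d C →
      Enters tail head d' C → d = d') :
    ∑ d ∈ F, cost d ≤ ∑ C ∈ U, y C := by
  classical
  calc ∑ d ∈ F, cost d = ∑ d ∈ F, ∑ C ∈ U, if Enters tail head d C then y C else 0 := by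
        refine Finset.sum_congr rfl fun d hd => ?_
        rw [ht d hd, load, Finset.sum_filter]
    _ = ∑ C ∈ U, ∑ d ∈ F, if Enters tail head d C then y C else 0 := Finset.sum_comm
    _ ≤ _ := by
        refine Finset.sum_le_sum fun C hC => ?_
        rw [← Finset.sum_filter, Finset.sum_const, nsmul_eq_mul]
        by_cases h : y C = 0
        · simp [h]
        have : (F.filter fun d => Enters tail head d C).card ≤ 1 := by
          rw [Finset.card_le_one]
          intro a ha b hb
          rw [Finset.mem_filter] at ha hb
          exact h₁ C hC h a ha.1 b hb.1 ha.2 hb.2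
        have h' : ((F.filter fun d => Enters tail head d C).card : ℝ) ≤ 1 := by exact_mod_cast this
        nlinarith [hy C hC]

/-- The choice of a directed link in the construction of a cover that enters every set of a laminar
family at most once. -/
theorem exists_enters_of_laminar {U S : Finset (Finset V)} {T : Set D} (hU : IsIntersecting U)
    (hSU : S ⊆ U)
    (hlam : ∀ A ∈ S, ∀ B ∈ S, Disjoint A B ∨ A ⊆ B ∨ B ⊆ A)
    (hT : ∀ C ∈ U, ∃ d ∈ T, Enters tail head d C)
    (hM : ∀ B ∈ S, ∀ C ∈ U, C ⊂ B → ∃ d ∈ T, tail d ∈ B ∧ Enters tail head d C)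
    {C : Finset V} (hC : C ∈ U) :
    ∃ d ∈ T, Enters tail head d C ∧ ∀ B ∈ S, Enters tail head d B → B ⊆ C := by
  by_cases hne : ∃ B ∈ S, (C ∩ B).Nonempty ∧ ¬ B ⊆ C
  · obtain ⟨B, hB⟩ := hne
    obtain ⟨B, -, hBmin⟩ := (S.filter fun B => (C ∩ B).Nonempty ∧ ¬ B ⊆ C).exists_le_minimal
      (Finset.mem_filter.2 hB)
    obtain ⟨hBS, hCB, hBC⟩ := Finset.mem_filter.1 hBmin.1
    -- A link with tail in `B` that enters `C ∩ B` has its tail outside `C`, so it enters `C`. A set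
    -- of `S` that it enters and that is not inside `C` would be comparable with `B` through the
    -- common head, contradicting the tail in `B` or the minimality of `B`.
    have hss : C ∩ B ⊂ B := by
      refine ⟨Finset.inter_subset_right, fun h => hBC (h.trans Finset.inter_subset_left)⟩
    obtain ⟨d, hdT, hdB, hd⟩ := hM B hBS _ (hU C hC B (hSU hBS) hCB).1 hss
    have hdC : Enters tail head d C := by
      refine ⟨fun h => hd.1 (Finset.mem_inter.2 ⟨h, hdB⟩), (Finset.mem_inter.1 hd.2).1⟩
    refine ⟨d, hdT, hdC, fun A hA hdA => ?_⟩
    by_contra hAC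
    have hAmem : A ∈ S.filter fun B => (C ∩ B).Nonempty ∧ ¬ B ⊆ C :=
      Finset.mem_filter.2 ⟨hA, ⟨head d, Finset.mem_inter.2 ⟨hdC.2, hdA.2⟩⟩, hAC⟩
    rcases hlam A hA B hBS with h | h | h
    · exact Finset.disjoint_left.1 h hdA.2 (Finset.mem_inter.1 hd.2).2
    · exact hdA.1 (hBmin.2 hAmem h hdB)
    · exact hdA.1 (h hdB)
  · push Not at hne
    obtain ⟨d, hdT, hd⟩ := hT C hC
    exact ⟨d, hdT, hd, fun B hB hdB => hne B hB ⟨head d, Finset.mem_inter.2 ⟨hd.2, hdB.2⟩⟩⟩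

/-- Links are added one at a time for an inclusionwise maximal set not yet entered, under the
invariant that no such set contains the head of a chosen link. The new link enters only those sets
of `S` that lie inside the maximal set, and by the invariant no earlier link has its head there. -/
theorem exists_cover_of_laminar {U S : Finset (Finset V)} {T : Set D} (hU : IsIntersecting U)
    (hSU : S ⊆ U)
    (hlam : ∀ A ∈ S, ∀ B ∈ S, Disjoint A B ∨ A ⊆ B ∨ B ⊆ A)
    (hT : ∀ C ∈ U, ∃ d ∈ T, Enters tail head d C)
    (hM : ∀ B ∈ S, ∀ C ∈ U, C ⊂ B → ∃ d ∈ T, tail d ∈ B ∧ Enters tail head d C) :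
    ∃ F : Finset D, (∀ d ∈ F, d ∈ T) ∧ (∀ C ∈ U, ∃ d ∈ F, Enters tail head d C) ∧
      ∀ B ∈ S, ∀ d ∈ F, ∀ d' ∈ F, Enters tail head d B → Enters tail head d' B → d = d' := by
  classical
  let N (F : Finset D) : Finset (Finset V) := U.filter fun C => ∀ d ∈ F, ¬ Enters tail head d C
  have main : ∀ (j : ℕ) (F : Finset D), (N F).card = j → (∀ d ∈ F, d ∈ T) →
      (∀ C ∈ N F, ∀ d ∈ F, head d ∉ C) →
      (∀ B ∈ S, ∀ d ∈ F, ∀ d' ∈ F, Enters tail head d B → Enters tail head d' B → d = d') →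
      ∃ F : Finset D, (∀ d ∈ F, d ∈ T) ∧ (∀ C ∈ U, ∃ d ∈ F, Enters tail head d C) ∧
        ∀ B ∈ S, ∀ d ∈ F, ∀ d' ∈ F, Enters tail head d B → Enters tail head d' B → d = d' := by
    intro j
    induction j using Nat.strong_induction_on with
    | _ j ih =>
      intro F hj hFT hFN hF₁
      by_cases hN : (N F).Nonempty
      swap
      · refine ⟨F, hFT, fun C hC => ?_, hF₁⟩
        by_contra! h
        exact hN ⟨C, Finset.mem_filter.2 ⟨hC, h⟩⟩
      obtain ⟨C₀, hC₀⟩ := hN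
      obtain ⟨C, -, hCmax⟩ := (N F).exists_le_maximal hC₀
      have hCN := hCmax.1
      obtain ⟨hCU, hCF⟩ := Finset.mem_filter.1 hCN
      obtain ⟨e, heT, heC, heS⟩ := exists_enters_of_laminar hU hSU hlam hT hM hCU
      have hsub : N (insert e F) ⊂ N F := by
        refine ⟨fun A hA => ?_, fun h => ?_⟩
        · obtain ⟨hA, hA'⟩ := Finset.mem_filter.1 hA
          exact Finset.mem_filter.2 ⟨hA, fun d hd => hA' d (Finset.mem_insert_of_mem hd)⟩
        · exact (Finset.mem_filter.1 (h hCN)).2 e (Finset.mem_insert_self _ _) heC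
      have key : ∀ B ∈ S, Enters tail head e B → ∀ d ∈ F, ¬ Enters tail head d B :=
        fun B hB heB d hd hdB => hFN C hCN d hd (heS B hB heB hdB.2)
      refine ih _ (hj ▸ Finset.card_lt_card hsub) (insert e F) rfl ?_ ?_ ?_
      · intro d hd
        rcases Finset.mem_insert.1 hd with rfl | hd
        exacts [heT, hFT d hd]
      · intro A hA d hd hdA
        rcases Finset.mem_insert.1 hd with rfl | hd
        · obtain ⟨hAU, hA'⟩ := Finset.mem_filter.1 hA
          -- If a set `A` that is still not entered contained the new head, then `C ∪ A` would be
          -- uncovered before, so `A ⊆ C` by maximality, and the new link would enter `A`.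
          have hAC : C ∪ A ∈ N F := by
            refine Finset.mem_filter.2
              ⟨(hU C hCU A hAU ⟨head d, Finset.mem_inter.2 ⟨heC.2, hdA⟩⟩).2, fun f hf h => ?_⟩
            rcases h.or_of_union with h | h
            exacts [hCF f hf h, hA' f (Finset.mem_insert_of_mem hf) h]
          have : A ⊆ C := Finset.subset_union_right.trans
            (hCmax.2 hAC Finset.subset_union_left)
          exact hA' d (Finset.mem_insert_self _ _) ⟨fun h => heC.1 (this h), hdA⟩
        · exact hFN A (hsub.1 hA) d hd hdA
      · intro B hB d hd d' hd' hdB hdB'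
        rcases Finset.mem_insert.1 hd with rfl | hdF <;>
          rcases Finset.mem_insert.1 hd' with rfl | hdF'
        · rfl
        · exact absurd hdB' (key B hB hdB d' hdF')
        · exact absurd hdB (key B hB hdB' d hdF)
        · exact hF₁ B hB d hdF d' hdF' hdB hdB'
  exact main _ ∅ rfl (by simp) (by simp) (by simp)

/-! ### The greedy algorithm -/

/-- The first `q` rounds of the greedy algorithm: in round `i` the dual variable of `C i`, a set
not entered by the directed links chosen before, is raised by `val i`, until the constraint of the
directed link `e i` becomes tight; all sets of `U` that are strictly contained in `C i` have been
entered by directed links chosen before. The residual costs are `res`. -/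
structure IsGreedy (tail head : D → V) (cost : D → ℝ) (U : Finset (Finset V)) (q : ℕ)
    (C : ℕ → Finset V) (e : ℕ → D) (val : ℕ → ℝ) (res : D → ℝ) : Prop where
  mem : ∀ i < q, C i ∈ U
  enters : ∀ i < q, Enters tail head (e i) (C i)
  not_enters : ∀ i < q, ∀ j < i, ¬ Enters tail head (e j) (C i)
  of_ssubset : ∀ i < q, ∀ A ∈ U, A ⊂ C i → ∃ j < i, Enters tail head (e j) A
  val_nonneg : ∀ i < q, 0 ≤ val i
  res_eq : ∀ d, res d = cost d - ∑ i ∈ Finset.range q, if Enters tail head d (C i) then val i else 0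
  res_nonneg : ∀ d, 0 ≤ res d
  res_zero : ∀ i < q, res (e i) = 0

theorem IsGreedy.zero {cost : D → ℝ} {U : Finset (Finset V)} (hc : ∀ d, 0 ≤ cost d)
    (C : ℕ → Finset V) (e : ℕ → D) (val : ℕ → ℝ) : IsGreedy tail head cost U 0 C e val cost where
  mem := by simp
  enters := by simp
  not_enters := by simp
  of_ssubset := by simp
  val_nonneg := by simp
  res_eq := by simp
  res_nonneg := hc
  res_zero := by simp

/-- The sequences are replaced by ones agreeing below `q`, since the program extends its arrays at
position `q`. Earlier links stay tight because none of them enters the new set, so their residual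
costs are not touched. -/
theorem IsGreedy.succ {cost : D → ℝ} {U : Finset (Finset V)} {q : ℕ}
    {C C' : ℕ → Finset V} {e e' : ℕ → D} {val val' : ℕ → ℝ} {res res' : D → ℝ}
    (h : IsGreedy tail head cost U q C e val res)
    (hC : ∀ i < q, C' i = C i) (he : ∀ i < q, e' i = e i) (hval : ∀ i < q, val' i = val i)
    (hU : C' q ∈ U) (hnot : ∀ j < q, ¬ Enters tail head (e j) (C' q))
    (hss : ∀ A ∈ U, A ⊂ C' q → ∃ j < q, Enters tail head (e j) A)
    (hent : Enters tail head (e' q) (C' q)) (hv : val' q = res (e' q))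
    (hmin : ∀ d, Enters tail head d (C' q) → res (e' q) ≤ res d)
    (hres : ∀ d, res' d = if Enters tail head d (C' q) then res d - val' q else res d) :
    IsGreedy tail head cost U (q + 1) C' e' val' res' where
  mem i hi := by
    rcases Nat.lt_succ_iff_lt_or_eq.1 hi with hi | rfl
    · rw [hC i hi]; exact h.mem i hi
    · exact hU
  enters i hi := by
    rcases Nat.lt_succ_iff_lt_or_eq.1 hi with hi | rfl
    · rw [hC i hi, he i hi]; exact h.enters i hi
    · exact hent
  not_enters i hi j hj := by
    rcases Nat.lt_succ_iff_lt_or_eq.1 hi with hi | rfl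
    · rw [hC i hi, he j (hj.trans hi)]; exact h.not_enters i hi j hj
    · rw [he j hj]; exact hnot j hj
  of_ssubset i hi A hA hAC := by
    rcases Nat.lt_succ_iff_lt_or_eq.1 hi with hi | rfl
    · rw [hC i hi] at hAC
      obtain ⟨j, hj, hj'⟩ := h.of_ssubset i hi A hA hAC
      exact ⟨j, hj, by rwa [he j (hj.trans hi)]⟩
    · obtain ⟨j, hj, hj'⟩ := hss A hA hAC
      exact ⟨j, hj, by rwa [he j hj]⟩
  val_nonneg i hi := by
    rcases Nat.lt_succ_iff_lt_or_eq.1 hi with hi | rfl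
    · rw [hval i hi]; exact h.val_nonneg i hi
    · rw [hv]; exact h.res_nonneg _
  res_eq d := by
    rw [hres, Finset.sum_range_succ, h.res_eq]
    have : ∀ i ∈ Finset.range q, (if Enters tail head d (C' i) then val' i else 0) =
        if Enters tail head d (C i) then val i else 0 := by
      intro i hi
      rw [Finset.mem_range] at hi
      rw [hC i hi, hval i hi]
    rw [Finset.sum_congr rfl this]
    split_ifs <;> ring
  res_nonneg d := by
    rw [hres]
    split_ifs with hd
    · rw [hv]; linarith [hmin d hd]
    · exact h.res_nonneg d
  res_zero i hi := by
    rcases Nat.lt_succ_iff_lt_or_eq.1 hi with hi | rfl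
    · rw [hres, he i hi, if_neg (hnot i hi)]; exact h.res_zero i hi
    · rw [hres, if_pos hent, hv, sub_self]

/-! ### Structure of the greedy sets and reverse selection -/

namespace IsGreedy

variable {cost : D → ℝ} {U : Finset (Finset V)} {q : ℕ}
    {C : ℕ → Finset V} {e : ℕ → D} {val : ℕ → ℝ} {res : D → ℝ}

/-- Otherwise `A ∩ C i` is a member of `U` strictly inside `C i`, hence entered by an earlier link.
That link would enter `A` or `C i`, and neither happens. -/
theorem subset_of_inter (h : IsGreedy tail head cost U q C e val res) (hU : IsIntersecting U)
    {A : Finset V} (hA : A ∈ U) {i : ℕ} (hi : i < q) (hne : (A ∩ C i).Nonempty)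
    (hnot : ∀ j < i, ¬ Enters tail head (e j) A) : C i ⊆ A := by
  by_contra hsub
  obtain ⟨j, hj, hj'⟩ := h.of_ssubset i hi _ (hU A hA _ (h.mem i hi) hne).1
    ⟨Finset.inter_subset_right, fun h => hsub (h.trans Finset.inter_subset_left)⟩
  rcases hj'.or_of_inter with h' | h'
  exacts [hnot j hj h', h.not_enters i hi j hj h']

theorem subset_of_lt (h : IsGreedy tail head cost U q C e val res) (hU : IsIntersecting U)
    {i j : ℕ} (hij : i < j) (hj : j < q) (hne : (C j ∩ C i).Nonempty) : C i ⊆ C j :=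
  h.subset_of_inter hU (h.mem j hj) (hij.trans hj) hne fun l hl =>
    h.not_enters j hj l (hl.trans hij)

/-- This bounds the number of rounds by the number of directed links. -/
theorem injOn (h : IsGreedy tail head cost U q C e val res) {i j : ℕ} (hi : i < q) (hj : j < q)
    (hij : e i = e j) : i = j := by
  rcases lt_trichotomy i j with hlt | rfl | hlt
  · exact absurd (hij ▸ h.enters j hj) (h.not_enters j hj i hlt)
  · rfl
  · exact absurd (hij ▸ h.enters i hi) (h.not_enters i hi j hlt)

/-- The rule for selecting, in reverse order, links of the greedy algorithm. -/
def Selects (tail head : D → V) (q : ℕ) (C : ℕ → Finset V) (e : ℕ → D) (sel : ℕ → Prop) : Prop :=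
  ∀ i < q, sel i ↔ ∀ j, i < j → j < q → sel j → ¬ Enters tail head (e j) (C i)

variable {sel : ℕ → Prop}

/-- Let `l < m` be selected with both links entering `C i`. Links chosen before round `i` do not
enter `C i`, so `i ≤ l`, and the intersecting sets form a chain `C i ⊆ C l ⊆ C m`. The link of round
`m` has its head in `C i` and its tail outside `C m`. It therefore enters `C l`, which forbids the
selection of `l`. -/
theorem Selects.eq_of_enters (h : IsGreedy tail head cost U q C e val res) (hU : IsIntersecting U)
    (hs : Selects tail head q C e sel) {i : ℕ} (hi : i < q) {l m : ℕ} (hl : l < q) (hm : m < q)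
    (hsl : sel l) (hsm : sel m) (hel : Enters tail head (e l) (C i))
    (hem : Enters tail head (e m) (C i)) : l = m := by
  have key : ∀ l m, l < m → m < q → sel l → sel m → Enters tail head (e l) (C i) →
      Enters tail head (e m) (C i) → False := by
    intro l m hlm hm hsl hsm hel hem
    have hl : l < q := hlm.trans hm
    have hil : i ≤ l := by
      by_contra! hlt
      exact h.not_enters i hi l hlt hel
    have hhead : head (e m) ∈ C l := by
      rcases hil.lt_or_eq with hil | rfl
      · exact h.subset_of_lt hU hil hl
          ⟨head (e l), Finset.mem_inter.2 ⟨(h.enters l hl).2, hel.2⟩⟩ hem.2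
      · exact hem.2
    have hsub : C l ⊆ C m := h.subset_of_lt hU hlm hm
      ⟨head (e m), Finset.mem_inter.2 ⟨(h.enters m hm).2, hhead⟩⟩
    exact (hs l hl).1 hsl m hlm hm hsm ⟨fun h' => (h.enters m hm).1 (hsub h'), hhead⟩
  rcases lt_trichotomy l m with hlm | rfl | hlm
  · exact (key l m hlm hm hsl hsm hel hem).elim
  · rfl
  · exact (key m l hlm hl hsm hsl hem hel).elim

/-- Take a maximal counterexample `A` and the first greedy link `e i` entering it, so that `C i ⊆
A`. It was rejected because of a later selected `e j` entering `C i`, whose tail must lie in `A`.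
The union `A ∪ C j` is strictly larger than `A`, hence entered by a selected link. That link must
enter `C j`, so it is `e j` itself, although the tail of `e j` lies in `A`. -/
theorem Selects.cover (h : IsGreedy tail head cost U q C e val res) (hU : IsIntersecting U)
    (hs : Selects tail head q C e sel)
    (hcov : ∀ A ∈ U, ∃ i < q, Enters tail head (e i) A) :
    ∀ A ∈ U, ∃ i < q, sel i ∧ Enters tail head (e i) A := by
  classical
  by_contra! hcon
  obtain ⟨A₀, hA₀, hA₀'⟩ := hcon
  obtain ⟨A, -, hmax⟩ := (U.filter fun A => ∀ i < q, sel i →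
    ¬ Enters tail head (e i) A).exists_le_maximal (Finset.mem_filter.2 ⟨hA₀, hA₀'⟩)
  obtain ⟨hAU, hA⟩ := Finset.mem_filter.1 hmax.1
  have hex := hcov A hAU
  obtain ⟨hi, hiA⟩ := Nat.find_spec hex
  set i := Nat.find hex
  have hlt : ∀ j < i, ¬ Enters tail head (e j) A := fun j hj h' =>
    Nat.find_min hex hj ⟨hj.trans hi, h'⟩
  have hCA : C i ⊆ A := h.subset_of_inter hU hAU hi
    ⟨head (e i), Finset.mem_inter.2 ⟨hiA.2, (h.enters i hi).2⟩⟩ hlt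
  have hnsel : ¬ sel i := fun h' => hA i hi h' hiA
  rw [hs i hi] at hnsel
  push Not at hnsel
  obtain ⟨j, hij, hj, hsj, hej⟩ := hnsel
  have htail : tail (e j) ∈ A := by
    by_contra h'
    exact hA j hj hsj ⟨h', hCA hej.2⟩
  have hne : (A ∩ C j).Nonempty :=
    ⟨head (e j), Finset.mem_inter.2 ⟨hCA hej.2, (h.enters j hj).2⟩⟩
  have hun := (hU A hAU _ (h.mem j hj) hne).2
  have hnot : ¬ A ∪ C j ⊆ A := by
    intro h'
    -- The union is strictly larger because of the tail of `e i`: it is outside `A`, but inside `C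
    -- j`, as `e i` has its head in `C j` without entering it.
    have hCij : C i ⊆ C j := h.subset_of_lt hU hij hj
      ⟨head (e j), Finset.mem_inter.2 ⟨(h.enters j hj).2, hej.2⟩⟩
    have : tail (e i) ∈ C j := by
      by_contra h''
      exact h.not_enters j hj i hij ⟨h'', hCij (h.enters i hi).2⟩
    exact hiA.1 (h' (Finset.mem_union_right _ this))
  have hexg : ∃ g < q, sel g ∧ Enters tail head (e g) (A ∪ C j) := by
    by_contra! h'
    exact hnot (hmax.2 (Finset.mem_filter.2 ⟨hun, h'⟩) Finset.subset_union_left)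
  obtain ⟨g, hg, hsg, heg⟩ := hexg
  rcases heg.or_of_union with h' | h'
  · exact hA g hg hsg h'
  · have := Selects.eq_of_enters h hU hs hj hg hj hsg hsj h' (h.enters j hj)
    subst this
    exact heg.1 (Finset.mem_union_left _ htail)

/-- Complementary slackness: the chosen links are tight, and each raised set pays for at most one
selected link. -/
theorem Selects.sum_cost_le (h : IsGreedy tail head cost U q C e val res) (hU : IsIntersecting U)
    (hs : Selects tail head q C e sel) [DecidablePred sel] :
    ∑ i ∈ Finset.range q with sel i, cost (e i) ≤ ∑ i ∈ Finset.range q, val i := by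
  calc ∑ i ∈ Finset.range q with sel i, cost (e i)
      = ∑ i ∈ Finset.range q with sel i, ∑ j ∈ Finset.range q,
          if Enters tail head (e i) (C j) then val j else 0 := by
        refine Finset.sum_congr rfl fun i hi => ?_
        rw [Finset.mem_filter, Finset.mem_range] at hi
        have h₁ := h.res_eq (e i)
        have h₂ := h.res_zero i hi.1
        linarith
    _ = ∑ j ∈ Finset.range q, ∑ i ∈ Finset.range q with sel i,
          if Enters tail head (e i) (C j) then val j else 0 := Finset.sum_comm
    _ ≤ _ := by
        refine Finset.sum_le_sum fun j hj => ?_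
        rw [Finset.mem_range] at hj
        rw [← Finset.sum_filter, Finset.sum_const, nsmul_eq_mul]
        have : (((Finset.range q).filter sel).filter
            fun i => Enters tail head (e i) (C j)).card ≤ 1 := by
          rw [Finset.card_le_one]
          intro a ha b hb
          simp only [Finset.mem_filter, Finset.mem_range] at ha hb
          exact Selects.eq_of_enters h hU hs hj ha.1.1 hb.1.1 ha.1.2 hb.1.2 ha.2 hb.2
        have h' : ((((Finset.range q).filter sel).filter
            fun i => Enters tail head (e i) (C j)).card : ℝ) ≤ 1 := by exact_mod_cast this
        nlinarith [h.val_nonneg j hj]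

/-- The dual solution that the greedy algorithm computes. -/
def dual (q : ℕ) (C : ℕ → Finset V) (val : ℕ → ℝ) (A : Finset V) : ℝ :=
  ∑ i ∈ Finset.range q, if C i = A then val i else 0

theorem dual_nonneg (h : IsGreedy tail head cost U q C e val res) (A : Finset V) :
    0 ≤ dual q C val A := by
  refine Finset.sum_nonneg fun i hi => ?_
  rw [Finset.mem_range] at hi
  split_ifs
  exacts [h.val_nonneg i hi, le_rfl]

theorem exists_eq_of_dual_ne_zero {A : Finset V} (hA : dual q C val A ≠ 0) : ∃ i < q, C i = A := by
  obtain ⟨i, hi, h⟩ := Finset.exists_ne_zero_of_sum_ne_zero hA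
  exact ⟨i, Finset.mem_range.1 hi, by by_contra h'; simp [h'] at h⟩

theorem sum_dual (h : IsGreedy tail head cost U q C e val res) :
    ∑ A ∈ U, dual q C val A = ∑ i ∈ Finset.range q, val i := by
  simp only [dual]
  rw [Finset.sum_comm]
  refine Finset.sum_congr rfl fun i hi => ?_
  rw [Finset.sum_ite_eq, if_pos (h.mem i (Finset.mem_range.1 hi))]

theorem load_dual (h : IsGreedy tail head cost U q C e val res) (d : D) :
    load tail head U (dual q C val) d = cost d - res d := by
  rw [h.res_eq, load]
  simp only [dual]
  rw [Finset.sum_comm, sub_sub_cancel]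
  refine Finset.sum_congr rfl fun i hi => ?_
  rw [Finset.sum_filter]
  have : ∀ A ∈ U, (if Enters tail head d A then if C i = A then val i else 0 else 0) =
      if C i = A then if Enters tail head d (C i) then val i else 0 else 0 := by
    intro A _
    by_cases hA : C i = A
    · simp [hA]
    · simp [hA]
  rw [Finset.sum_congr rfl this, Finset.sum_ite_eq, if_pos (h.mem i (Finset.mem_range.1 hi))]

end IsGreedy

end Covering

theorem Finset.exists_pos_forall_le {ι : Type*} (s : Finset ι) (f : ι → ℝ)
    (hf : ∀ i ∈ s, 0 < f i) : ∃ ε > 0, ∀ i ∈ s, ε ≤ f i := by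
  rcases s.eq_empty_or_nonempty with rfl | hs
  · exact ⟨1, one_pos, by simp⟩
  · obtain ⟨i, hi, h⟩ := s.exists_min_image f hs
    exact ⟨f i, hf i hi, h⟩

/-! ### Cuts of a cactus -/

namespace Multigraph

variable {V E L : Type*}

theorem mem_boundary [Fintype E] {G : Multigraph V E} {C : Finset V} {e : E} :
    e ∈ G.boundary C ↔ Xor (G.fst e ∈ C) (G.snd e ∈ C) := by
  simp [boundary]

theorem Joins.symm {G : Multigraph V E} {e : E} {u v : V} (h : G.Joins e u v) : G.Joins e v u :=
  Or.symm h

theorem Joins.mem_boundary_iff [Fintype E] {G : Multigraph V E} {C : Finset V} {e : E} {u v : V}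
    (h : G.Joins e u v) : e ∈ G.boundary C ↔ Xor (u ∈ C) (v ∈ C) := by
  rw [mem_boundary]
  rcases h with ⟨rfl, rfl⟩ | ⟨rfl, rfl⟩
  · rfl
  · rw [xor_comm]

theorem mem_boundary_iff_exists [Fintype E] {G : Multigraph V E} {C : Finset V} {e : E} :
    e ∈ G.boundary C ↔ ∃ u v, G.Joins e u v ∧ u ∈ C ∧ v ∉ C := by
  constructor
  · intro h
    rcases mem_boundary.1 h with h | h
    · exact ⟨_, _, Or.inl ⟨rfl, rfl⟩, h⟩
    · exact ⟨_, _, Or.inr ⟨rfl, rfl⟩, h⟩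
  · rintro ⟨u, v, h, hu, hv⟩
    exact h.mem_boundary_iff.2 (Or.inl ⟨hu, hv⟩)

theorem toSimple_adj_of_joins {G : Multigraph V E} {e : E} {u v : V} (h : G.Joins e u v)
    (hne : u ≠ v) : G.toSimple.Adj u v :=
  (SimpleGraph.fromRel_adj _ _ _).2 ⟨hne, Or.inl ⟨e, h⟩⟩

theorem exists_joins_of_adj {G : Multigraph V E} {u v : V} (h : G.toSimple.Adj u v) :
    ∃ e, G.Joins e u v := by
  rcases ((SimpleGraph.fromRel_adj _ _ _).1 h).2 with ⟨e, he⟩ | ⟨e, he⟩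
  exacts [⟨e, he⟩, ⟨e, he.symm⟩]

variable [Fintype V] [Fintype E] [DecidableEq V] {G : Multigraph V E}

theorem boundary_compl (C : Finset V) : G.boundary Cᶜ = G.boundary C := by
  ext e
  simp only [mem_boundary, Finset.mem_compl]
  unfold Xor
  tauto

theorem card_boundary_inter_add_union (A B : Finset V) :
    (G.boundary (A ∩ B)).card + (G.boundary (A ∪ B)).card ≤
      (G.boundary A).card + (G.boundary B).card := by
  classical
  simp only [boundary, Finset.card_filter, ← Finset.sum_add_distrib]
  refine Finset.sum_le_sum fun e _ => ?_
  simp only [Finset.mem_inter, Finset.mem_union]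
  by_cases h₁ : G.fst e ∈ A <;> by_cases h₂ : G.snd e ∈ A <;> by_cases h₃ : G.fst e ∈ B <;>
    by_cases h₄ : G.snd e ∈ B <;> simp [Xor, h₁, h₂, h₃, h₄]

/-- Connectivity gives one edge in the cut. A cycle through it crosses the cut equally often in both
directions, so a second edge is present. -/
theorem IsCactus.two_le_card_boundary (h : G.IsCactus) {S : Finset V} (hne : S.Nonempty)
    (huniv : S ≠ Finset.univ) : 2 ≤ (G.boundary S).card := by
  classical
  obtain ⟨u, hu⟩ := hne
  obtain ⟨w, hw⟩ : ∃ w, w ∉ S := by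
    by_contra! hall
    exact huniv (Finset.eq_univ_iff_forall.2 hall)
  obtain ⟨p⟩ := h.1.preconnected u w
  obtain ⟨d, -, hd, hd'⟩ := p.exists_boundary_dart (S : Set V) hu hw
  obtain ⟨e, he⟩ := exists_joins_of_adj d.adj
  have heS : e ∈ G.boundary S := he.mem_boundary_iff.2 (Or.inl ⟨hd, hd'⟩)
  by_contra! hlt
  have hone : ∀ g ∈ G.boundary S, g = e := fun g hg =>
    Finset.card_le_one.1 (by omega) g hg e heS
  obtain ⟨D, ⟨⟨l, v, c, -, hc, hj, rfl⟩, i, rfl⟩, -⟩ := h.2 e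
  -- The sum telescopes cyclically. If the cut had only one edge, exactly one term would be nonzero,
  -- namely `1` or `-1`.
  have hsum : ∑ j, ((if v j ∈ S then 1 else 0 : ℤ) - if v (j + 1) ∈ S then 1 else 0) = 0 := by
    rw [Finset.sum_sub_distrib, sub_eq_zero]
    exact (Equiv.sum_comp (Equiv.addRight (1 : Fin (l + 2)))
      (fun j => (if v j ∈ S then 1 else 0 : ℤ))).symm
  rw [Finset.sum_eq_single i] at hsum
  · rw [(hj i).mem_boundary_iff] at heS
    rcases heS with ⟨h₁, h₂⟩ | ⟨h₁, h₂⟩ <;> simp [h₁, h₂] at hsum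
  · intro j _ hji
    have : c j ∉ G.boundary S := fun hmem => hji (hc (hone _ hmem))
    rw [(hj j).mem_boundary_iff] at this
    by_cases h₁ : v j ∈ S <;> by_cases h₂ : v (j + 1) ∈ S <;> simp [Xor, h₁, h₂] at this ⊢
  · simp

/-- The sides of a `2`-cut of a cactus are connected. -/
theorem IsCactus.exists_joins_of_card_boundary_eq_two (h : G.IsCactus) {A B : Finset V}
    (hA : A.Nonempty) (hB : B.Nonempty) (hAB : Disjoint A B)
    (hC : (G.boundary (A ∪ B)).card = 2) :
    ∃ e a b, G.Joins e a b ∧ a ∈ A ∧ b ∈ B := by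
  by_contra! hno
  have hsub : ∀ A' B' : Finset V, A' ∪ B' = A ∪ B →
      (∀ e a b, G.Joins e a b → a ∈ A' → b ∉ B') → G.boundary A' ⊆ G.boundary (A ∪ B) := by
    intro A' B' hu hno' e he
    obtain ⟨u, v, hj, hu', hv⟩ := mem_boundary_iff_exists.1 he
    refine mem_boundary_iff_exists.2 ⟨u, v, hj, hu ▸ Finset.mem_union_left _ hu', fun hv' => ?_⟩
    rcases Finset.mem_union.1 (hu ▸ hv') with h' | h'
    exacts [hv h', hno' e u v hj hu' h']
  have h₁ := hsub A B rfl hno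
  have h₂ := hsub B A (Finset.union_comm _ _) fun e a b hj ha hb => hno e b a hj.symm hb ha
  have hAu : A ≠ Finset.univ := fun hu => by
    obtain ⟨b, hb⟩ := hB
    exact Finset.disjoint_left.1 hAB (hu ▸ Finset.mem_univ b) hb
  have hBu : B ≠ Finset.univ := fun hu => by
    obtain ⟨a, ha⟩ := hA
    exact Finset.disjoint_left.1 hAB ha (hu ▸ Finset.mem_univ a)
  -- With no edge between `A` and `B`, both boundaries lie in the two-element boundary of the union
  -- and have at least two elements, so all three coincide. An edge leaving `A` then also leaves
  -- `B`, hence joins `A` to `B`.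
  have h₃ := Finset.eq_of_subset_of_card_le h₁ (hC ▸ h.two_le_card_boundary hA hAu)
  have h₄ := Finset.eq_of_subset_of_card_le h₂ (hC ▸ h.two_le_card_boundary hB hBu)
  obtain ⟨e, he⟩ : (G.boundary A).Nonempty := by
    rw [← Finset.card_pos, h₃, hC]
    exact two_pos
  obtain ⟨u, v, hj, hu, hv⟩ := mem_boundary_iff_exists.1 he
  have he' := h₄ ▸ h₃ ▸ he
  rw [hj.mem_boundary_iff] at he'
  have hub : u ∉ B := fun h' => Finset.disjoint_left.1 hAB hu h'
  rcases he' with ⟨h', -⟩ | ⟨h', -⟩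
  exacts [hub h', hno e u v hj hu h']

/-- A `2`-cut that does not contain `r` lies in a principal subcactus. -/
theorem IsCactus.exists_isPrincipal (h : G.IsCactus) {r : V} {C : Finset V} (hr : r ∉ C)
    (hC : (G.boundary C).card = 2) {u v : V} (hu : u ∈ C) (hv : v ∈ C) :
    ∃ U, G.IsPrincipal r U ∧ u ∈ U ∧ v ∈ U := by
  classical
  have hne : ∀ w ∈ C, w ≠ r := fun w hw hwr => hr (hwr ▸ hw)
  let H := G.toSimple.induce {v | v ≠ r}
  -- If `v` were not reachable from `u` outside `r`, then `A` and `C \ A` would split `C`. An edge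
  -- joins these parts because the side of a 2-cut is connected, and it extends reachability.
  let A := C.filter fun w => ∃ hw : w ≠ r, H.Reachable ⟨u, hne u hu⟩ ⟨w, hw⟩
  suffices hvA : v ∈ A by
    obtain ⟨-, hvr, hreach⟩ := Finset.mem_filter.1 hvA
    refine ⟨_, ⟨H.connectedComponentMk ⟨u, hne u hu⟩, rfl⟩, Or.inr ⟨⟨u, hne u hu⟩, ?_, rfl⟩,
      Or.inr ⟨⟨v, hvr⟩, ?_, rfl⟩⟩
    · rfl
    · exact SimpleGraph.ConnectedComponent.eq.2 hreach.symm
  by_contra hvA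
  have huA : u ∈ A := Finset.mem_filter.2 ⟨hu, hne u hu, SimpleGraph.Reachable.refl _⟩
  have hAC : A ⊆ C := Finset.filter_subset _ _
  obtain ⟨e, a, b, hj, ha, hb⟩ := h.exists_joins_of_card_boundary_eq_two (A := A) (B := C \ A)
    ⟨u, huA⟩ ⟨v, Finset.mem_sdiff.2 ⟨hv, hvA⟩⟩ Finset.disjoint_sdiff
    (by rwa [Finset.union_sdiff_of_subset hAC])
  obtain ⟨hbC, hbA⟩ := Finset.mem_sdiff.1 hb
  obtain ⟨haC, har, hreach⟩ := Finset.mem_filter.1 ha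
  refine hbA (Finset.mem_filter.2 ⟨hbC, hne b hbC, hreach.trans ?_⟩)
  refine SimpleGraph.Adj.reachable ?_
  have hab : a ≠ b := fun h' => hbA (h' ▸ ha)
  exact toSimple_adj_of_joins hj hab

/-! ### Describing 2-cuts by pairs of edges -/

variable {n m : ℕ}

open Classical in
/-- The vertices separated from `r` by the edges with numbers `e` and `f`: the union of all sets
not containing `r` whose boundary consists of these edges. -/
noncomputable def separated (G : Multigraph V (Fin m)) (r : V) (e f : ℕ) : Finset V :=
  Finset.univ.filter fun v => ∃ D : Finset V, r ∉ D ∧ v ∈ D ∧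
    ∀ g ∈ G.boundary D, (g : ℕ) = e ∨ (g : ℕ) = f

variable {G : Multigraph V (Fin m)} {r : V} {e f : ℕ}

theorem mem_separated {v : V} : v ∈ G.separated r e f ↔ ∃ D : Finset V, r ∉ D ∧ v ∈ D ∧
    ∀ g ∈ G.boundary D, (g : ℕ) = e ∨ (g : ℕ) = f := by
  simp [separated]

theorem notMem_separated : r ∉ G.separated r e f := by
  rw [mem_separated]
  rintro ⟨D, h, h', -⟩
  exact h h'

/-- An edge leaving a union of sets leaves one of them, so the boundary is contained in the given
pair. The general lower bound for cuts does the rest. -/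
theorem IsCactus.card_boundary_separated (h : G.IsCactus)
    (hne : (G.separated r e f).Nonempty) : (G.boundary (G.separated r e f)).card = 2 := by
  classical
  refine le_antisymm ?_ (h.two_le_card_boundary hne fun hu =>
    notMem_separated (G := G) (r := r) (e := e) (f := f) (hu ▸ Finset.mem_univ r))
  have hsub : (G.boundary (G.separated r e f)).image (fun g : Fin m => (g : ℕ)) ⊆ {e, f} := by
    intro g' hg'
    obtain ⟨g, hg, rfl⟩ := Finset.mem_image.1 hg'
    obtain ⟨u, v, hj, hu, hv⟩ := mem_boundary_iff_exists.1 hg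
    obtain ⟨D, hrD, huD, hD⟩ := mem_separated.1 hu
    have hvD : v ∉ D := fun h' => hv (mem_separated.2 ⟨D, hrD, h', hD⟩)
    simpa using hD g (mem_boundary_iff_exists.2 ⟨u, v, hj, huD, hvD⟩)
  rw [← Finset.card_image_of_injective (G.boundary (G.separated r e f)) Fin.val_injective]
  exact (Finset.card_le_card hsub).trans Finset.card_le_two

/-- The two boundary edges of `C` work. A set `D` avoiding the root, with boundary among them and
reaching outside `C`, would split the connected complement of `C`. An edge across this split would
belong to the boundary of `C` while having both ends outside `C`. -/
theorem IsCactus.exists_separated_eq (h : G.IsCactus) {C : Finset V} (hr : r ∉ C)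
    (hC : (G.boundary C).card = 2) : ∃ e < m, ∃ f < m, G.separated r e f = C := by
  obtain ⟨e, f, -, hef⟩ := Finset.card_eq_two.1 hC
  refine ⟨e, e.2, f, f.2, Finset.Subset.antisymm (fun v hv => ?_) fun v hv => ?_⟩
  · obtain ⟨D, hrD, hvD, hD⟩ := mem_separated.1 hv
    by_contra hvC
    have hu : D \ C ∪ (Cᶜ \ D) = Cᶜ := by
      ext w
      simp only [Finset.mem_union, Finset.mem_sdiff, Finset.mem_compl]
      tauto
    obtain ⟨g, a, b, hj, ha, hb⟩ := h.exists_joins_of_card_boundary_eq_two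
      (A := D \ C) (B := Cᶜ \ D) ⟨v, Finset.mem_sdiff.2 ⟨hvD, hvC⟩⟩
      ⟨r, Finset.mem_sdiff.2 ⟨Finset.mem_compl.2 hr, hrD⟩⟩
      (Finset.disjoint_left.2 fun w hw hw' =>
        (Finset.mem_sdiff.1 hw').2 (Finset.mem_sdiff.1 hw).1)
      (by rw [hu, boundary_compl, hC])
    rw [Finset.mem_sdiff] at ha hb
    rw [Finset.mem_compl] at hb
    have hg : g ∈ G.boundary C := by
      have := hD g (mem_boundary_iff_exists.2 ⟨a, b, hj, ha.1, hb.2⟩)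
      rw [hef]
      simpa [Fin.ext_iff] using this
    rw [hj.mem_boundary_iff] at hg
    unfold Xor at hg
    tauto
  · refine mem_separated.2 ⟨C, hr, hv, fun g hg => ?_⟩
    rw [hef] at hg
    simpa [Fin.ext_iff] using hg

end Multigraph

/-! ### Directed links of an instance -/

namespace CacAP

section Directed

variable {V E : Type*} {k : ℕ} (I : CacAP V E (Fin k))

/-- The tail of the directed link `d`: the directed links `ℓ` and `k + ℓ` are the two orientations
of the link `ℓ < k`; for `2 k ≤ d` it is a loop at the root. -/
def tail (d : ℕ) : V :=
  if h : d < k then I.links.fst ⟨d, h⟩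
  else if h : d - k < k then I.links.snd ⟨d - k, h⟩ else I.root

/-- The head of the directed link `d`. -/
def head (d : ℕ) : V :=
  if h : d < k then I.links.snd ⟨d, h⟩
  else if h : d - k < k then I.links.fst ⟨d - k, h⟩ else I.root

/-- The cost of the directed link `d`. -/
def dcost (d : ℕ) : ℝ := RAM.pad I.cost (if d < k then d else d - k)

theorem dcost_nonneg (d : ℕ) : 0 ≤ I.dcost d := by
  unfold dcost RAM.pad
  split_ifs <;> first | exact I.cost_nonneg _ | exact le_rfl

theorem exists_directed {ℓ : Fin k} {u v : V} (h : I.links.Joins ℓ u v) :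
    ∃ d, I.tail d = u ∧ I.head d = v ∧ I.dcost d = I.cost ℓ := by
  rcases h with ⟨rfl, rfl⟩ | ⟨rfl, rfl⟩
  · exact ⟨ℓ, by simp [tail], by simp [head], by simp [dcost, RAM.pad]⟩
  · exact ⟨k + ℓ, by simp [tail], by simp [head], by simp [dcost, RAM.pad]⟩

theorem joins_directed {d : ℕ} (hd : d < k + k) :
    ∃ ℓ : Fin k, (ℓ : ℕ) = (if d < k then d else d - k) ∧
      I.links.Joins ℓ (I.tail d) (I.head d) ∧ I.dcost d = I.cost ℓ := by
  by_cases h : d < k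
  · exact ⟨⟨d, h⟩, by simp [h], Or.inl ⟨by simp [tail, h], by simp [head, h]⟩,
      by simp [dcost, RAM.pad, h]⟩
  · have h' : d - k < k := by omega
    exact ⟨⟨d - k, h'⟩, by simp [h], Or.inr ⟨by simp [head, h, h'], by simp [tail, h, h']⟩,
      by simp [dcost, RAM.pad, h, h']⟩

variable [DecidableEq V]

/-- Indices from `2 k` on are loops and enter nothing, so directed links may be indexed by all
natural numbers. -/
theorem lt_of_enters {d : ℕ} {C : Finset V} (h : Enters I.tail I.head d C) : d < k + k := by
  by_contra h'
  have h₁ : ¬ d < k := by omega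
  have h₂ : ¬ d - k < k := by omega
  simp [Enters, tail, head, h₁, h₂] at h

theorem mem_boundary_links_iff [Fintype V] {ℓ : Fin k} {C : Finset V} :
    ℓ ∈ I.links.boundary C ↔ ∃ u v, I.links.Joins ℓ u v ∧ u ∉ C ∧ v ∈ C := by
  rw [Multigraph.mem_boundary_iff_exists]
  constructor
  · rintro ⟨u, v, h, hu, hv⟩
    exact ⟨v, u, h.symm, hv, hu⟩
  · rintro ⟨u, v, h, hu, hv⟩
    exact ⟨v, u, h.symm, hv, hu⟩

end Directed

variable {V E L : Type*} [Fintype V] [Fintype E] [Fintype L] [DecidableEq V]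

theorem mem_twoCuts {I : CacAP V E L} {C : Finset V} :
    C ∈ I.twoCuts ↔ I.root ∉ C ∧ (I.graph.boundary C).card = 2 := by
  simp [twoCuts]

theorem mem_uncrossedCuts {I : CacAP V E L} {R : Finset L} {C : Finset V} :
    C ∈ I.uncrossedCuts R ↔ C ∈ I.twoCuts ∧ ∀ ℓ ∈ R, ℓ ∉ I.links.boundary C := by
  classical
  rw [uncrossedCuts, Finset.mem_filter, and_congr_right_iff]
  intro _
  constructor
  · intro h ℓ hℓ hℓ'
    have : ℓ ∈ (∅ : Finset L) := h ▸ Finset.mem_inter.2 ⟨hℓ', hℓ⟩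
    simp at this
  · intro h
    refine Finset.eq_empty_of_forall_notMem fun ℓ hℓ => ?_
    exact h ℓ (Finset.mem_inter.1 hℓ).2 (Finset.mem_inter.1 hℓ).1

theorem uncrossedCuts_subset (I : CacAP V E L) (R : Finset L) : I.uncrossedCuts R ⊆ I.twoCuts :=
  fun _ h => (mem_uncrossedCuts.1 h).1

theorem uncrossedCuts_empty (I : CacAP V E L) : I.uncrossedCuts ∅ = I.twoCuts := by
  ext C
  simp [mem_uncrossedCuts]

theorem nonempty_of_mem_twoCuts {I : CacAP V E L} {C : Finset V} (h : C ∈ I.twoCuts) :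
    C.Nonempty := by
  by_contra h'
  rw [Finset.not_nonempty_iff_eq_empty] at h'
  have := (mem_twoCuts.1 h).2
  subst h'
  have h₀ : I.graph.boundary ∅ = ∅ := by
    ext e
    simp [Multigraph.mem_boundary, Xor]
  simp [h₀] at this

/-- By submodularity the boundaries of intersection and union have at most four edges in total, and
each has at least two. A link crossing neither `A` nor `B` crosses neither their intersection nor
their union. -/
theorem isIntersecting_uncrossedCuts (I : CacAP V E L) (R : Finset L) :
    IsIntersecting (I.uncrossedCuts R) := by
  intro A hA B hB hne
  rw [mem_uncrossedCuts, mem_twoCuts] at hA hB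
  obtain ⟨⟨hrA, hA⟩, hRA⟩ := hA
  obtain ⟨⟨hrB, hB⟩, hRB⟩ := hB
  have hri : I.root ∉ A ∩ B := fun h => hrA (Finset.mem_inter.1 h).1
  have hru : I.root ∉ A ∪ B := fun h => (Finset.mem_union.1 h).elim hrA hrB
  have h₁ := I.isCactus.two_le_card_boundary hne fun h => hri (h ▸ Finset.mem_univ _)
  have h₂ := I.isCactus.two_le_card_boundary
    (hne.mono (Finset.inter_subset_left.trans Finset.subset_union_left))
    fun h => hru (h ▸ Finset.mem_univ _)
  have h₃ := I.graph.card_boundary_inter_add_union A B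
  rw [mem_uncrossedCuts, mem_uncrossedCuts, mem_twoCuts, mem_twoCuts]
  refine ⟨⟨⟨hri, by omega⟩, fun ℓ hℓ => ?_⟩, ⟨⟨hru, by omega⟩, fun ℓ hℓ => ?_⟩⟩ <;>
  · have h₄ := hRA ℓ hℓ
    have h₅ := hRB ℓ hℓ
    simp only [Multigraph.mem_boundary, Xor, Finset.mem_inter, Finset.mem_union] at h₄ h₅ ⊢
    tauto

/-- A link of `R` crossing `A` but not `B` would have both ends in `B`, hence in one principal
subcactus, which a cross-link does not. -/
theorem mem_uncrossedCuts_of_subset {I : CacAP V E L} {R : Finset L} (hR : R ⊆ I.crossLinks)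
    {A B : Finset V} (hB : B ∈ I.uncrossedCuts R) (hA : A ∈ I.twoCuts) (hAB : A ⊆ B) :
    A ∈ I.uncrossedCuts R := by
  refine mem_uncrossedCuts.2 ⟨hA, fun ℓ hℓ hℓA => ?_⟩
  have hℓB := (mem_uncrossedCuts.1 hB).2 ℓ hℓ
  obtain ⟨hrB, hB2⟩ := mem_twoCuts.1 (uncrossedCuts_subset I R hB)
  have hboth : I.links.fst ℓ ∈ B ∧ I.links.snd ℓ ∈ B := by
    rw [Multigraph.mem_boundary] at hℓA hℓB
    rcases hℓA with ⟨h, -⟩ | ⟨h, -⟩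
    · have := hAB h
      unfold Xor at hℓB
      tauto
    · have := hAB h
      unfold Xor at hℓB
      tauto
  classical
  exact (Finset.mem_filter.1 (hR hℓ)).2 (I.isCactus.exists_isPrincipal hrB hB2 hboth.1 hboth.2)

theorem three_le_card_boundary_augment_iff {G : Multigraph V E} {H : Multigraph V L}
    {F : Finset L} {S : Finset V} (h : (G.boundary S).card = 2) :
    3 ≤ ((G.augment H F).boundary S).card ↔ ∃ ℓ ∈ F, ℓ ∈ H.boundary S := by
  classical
  obtain ⟨T, hT⟩ : ∃ T : Finset {ℓ // ℓ ∈ F}, ∀ ℓ, ℓ ∈ T ↔ ℓ.1 ∈ H.boundary S :=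
    ⟨Finset.univ.filter fun ℓ => ℓ.1 ∈ H.boundary S, by simp⟩
  have hset : (G.augment H F).boundary S = (G.boundary S).disjSum T := by
    ext (e | ℓ) <;> simp [Multigraph.mem_boundary, Multigraph.augment, hT]
  rw [hset, Finset.card_disjSum, h]
  constructor
  · intro h'
    have hpos : 0 < T.card := by omega
    obtain ⟨⟨ℓ, hℓ⟩, hℓ'⟩ := Finset.card_pos.1 hpos
    exact ⟨ℓ, hℓ, (hT _).1 hℓ'⟩
  · rintro ⟨ℓ, hℓ, hℓ'⟩
    have : 0 < T.card := Finset.card_pos.2 ⟨⟨ℓ, hℓ⟩, (hT _).2 hℓ'⟩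
    omega

/-- Cuts with at least three edges need nothing, and a 2-cut containing the root is replaced by its
complement. -/
theorem isSolution_iff (I : CacAP V E L) (F : Finset L) :
    I.IsSolution F ↔ ∀ C ∈ I.twoCuts, ∃ ℓ ∈ F, ℓ ∈ I.links.boundary C := by
  classical
  constructor
  · intro h C hC
    obtain ⟨hr, h2⟩ := mem_twoCuts.1 hC
    exact (three_le_card_boundary_augment_iff h2).1
      (h C (nonempty_of_mem_twoCuts hC) fun hu => hr (hu ▸ Finset.mem_univ _))
  · intro h S hne hu
    have hle := I.isCactus.two_le_card_boundary hne hu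
    rcases hle.lt_or_eq with hlt | heq
    · refine le_trans (Nat.succ_le_of_lt hlt) ?_
      rw [← Finset.card_map (Function.Embedding.inl (β := {ℓ // ℓ ∈ F}))]
      refine Finset.card_le_card fun e he => ?_
      obtain ⟨e, he, rfl⟩ := Finset.mem_map.1 he
      simpa [Multigraph.mem_boundary, Multigraph.augment] using he
    · rw [three_le_card_boundary_augment_iff heq.symm]
      by_cases hr : I.root ∈ S
      · obtain ⟨ℓ, hℓ, hℓ'⟩ := h Sᶜ (mem_twoCuts.2
          ⟨by simpa using hr, by rw [Multigraph.boundary_compl, heq]⟩)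
        exact ⟨ℓ, hℓ, by rwa [Multigraph.boundary_compl] at hℓ'⟩
      · exact h S (mem_twoCuts.2 ⟨hr, heq.symm⟩)

/-! ### Dual solutions -/

section Dual

variable {k : ℕ} {I : CacAP V E (Fin k)} {y : Finset V → ℝ}

theorem dualFeasible_iff : I.DualFeasible y ↔ (∀ C ∈ I.twoCuts, 0 ≤ y C) ∧
    ∀ d, load I.tail I.head I.twoCuts y d ≤ I.dcost d := by
  refine and_congr_right fun _ => ⟨fun h d => ?_, fun h ℓ u v hj => ?_⟩
  · by_cases hd : d < k + k
    · obtain ⟨ℓ, -, hj, hc⟩ := I.joins_directed hd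
      rw [hc]
      convert h ℓ _ _ hj using 1
      unfold load Enters
      congr!
      exact congrArg (fun i C => @Finset.filter _ _ i C) (Subsingleton.elim _ _)
    · refine le_trans (le_of_eq ?_) (I.dcost_nonneg d)
      refine Finset.sum_eq_zero fun C hC => ?_
      exact absurd (I.lt_of_enters (Finset.mem_filter.1 hC).2) hd
  · obtain ⟨d, rfl, rfl, hc⟩ := I.exists_directed hj
    rw [← hc]
    convert h d using 1
    unfold load Enters
    congr!
    exact congrArg (fun i C => @Finset.filter _ _ i C) (Subsingleton.elim _ _)

theorem load_add_single {U : Finset (Finset V)} {C : Finset V} (hC : C ∈ U) (ε : ℝ) (d : ℕ) :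
    load I.tail I.head U (fun A => y A + if A = C then ε else 0) d =
      load I.tail I.head U y d + if Enters I.tail I.head d C then ε else 0 := by
  rw [load, load, Finset.sum_add_distrib, Finset.sum_ite_eq']
  simp [hC]

theorem exists_pos_le_slack (hy : I.DualFeasible y) (p : ℕ → Prop)
    (hp : ∀ d < k + k, p d → load I.tail I.head I.twoCuts y d ≠ I.dcost d) :
    ∃ ε > 0, ∀ d < k + k, p d → load I.tail I.head I.twoCuts y d + ε ≤ I.dcost d := by
  classical
  obtain ⟨ε, hε, h⟩ := Finset.exists_pos_forall_le ((Finset.range (k + k)).filter p)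
    (fun d => I.dcost d - load I.tail I.head I.twoCuts y d) (by
      intro d hd
      rw [Finset.mem_filter, Finset.mem_range] at hd
      exact sub_pos.2 (lt_of_le_of_ne ((dualFeasible_iff.1 hy).2 d) (hp d hd.1 hd.2)))
  refine ⟨ε, hε, fun d hd hpd => ?_⟩
  linarith [h d (Finset.mem_filter.2 ⟨Finset.mem_range.2 hd, hpd⟩)]

/-- Otherwise `y C` could be increased. -/
theorem DualOptimal.exists_tight (hy : I.DualOptimal y) {C : Finset V} (hC : C ∈ I.twoCuts) :
    ∃ d, Enters I.tail I.head d C ∧ load I.tail I.head I.twoCuts y d = I.dcost d := by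
  by_contra! hno
  obtain ⟨ε, hε, h⟩ := exists_pos_le_slack hy.1 (fun d => Enters I.tail I.head d C)
    fun d _ => hno d
  have hfeas : I.DualFeasible fun A => y A + if A = C then ε else 0 := by
    refine dualFeasible_iff.2 ⟨fun A hA => ?_, fun d => ?_⟩
    · have := hy.1.1 A hA
      split_ifs <;> linarith
    · rw [load_add_single hC]
      split_ifs with hd
      · exact h d (I.lt_of_enters hd) hd
      · simpa using (dualFeasible_iff.1 hy.1).2 d
  have := hy.2 _ hfeas
  rw [Finset.sum_add_distrib, Finset.sum_ite_eq', if_pos hC] at this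
  linarith

/-- Weight moved from `B` to `C` increases the load only of links that enter `C` but not `B`, which
are those with tail in `B`. If all of them had slack, a small shift would be feasible. -/
theorem DualMinimal.exists_tight (hy : I.DualFeasible y) (hm : I.DualMinimal y)
    {C B : Finset V} (hC : C ∈ I.twoCuts) (hB : B ∈ I.twoCuts) (hCB : C ⊂ B) (hyB : y B ≠ 0) :
    ∃ d, I.tail d ∈ B ∧ Enters I.tail I.head d C ∧
      load I.tail I.head I.twoCuts y d = I.dcost d := by
  by_contra! hno
  obtain ⟨ε, hε, h⟩ := exists_pos_le_slack hy
    (fun d => I.tail d ∈ B ∧ Enters I.tail I.head d C) fun d _ hd => hno d hd.1 hd.2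
  have hyB' : 0 < y B := lt_of_le_of_ne (hy.1 B hB) (Ne.symm hyB)
  have hη : 0 < min ε (y B) := lt_min hε hyB'
  refine hm (min ε (y B)) hη C hC B hB hCB ?_
  have heq : (fun A => y A - (if A = B then min ε (y B) else 0) +
      if A = C then min ε (y B) else 0) = fun A => (y A + if A = B then - min ε (y B) else 0) +
        if A = C then min ε (y B) else 0 := by
    funext A
    split_ifs <;> ring
  have hfeas : I.DualFeasible fun A => y A - (if A = B then min ε (y B) else 0) +
      if A = C then min ε (y B) else 0 := by
    refine dualFeasible_iff.2 ⟨fun A hA => ?_, fun d => ?_⟩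
    · have := hy.1 A hA
      have := min_le_right ε (y B)
      split_ifs with h₁ h₂ h₂
      · linarith
      · rw [h₁]; linarith
      · linarith
      · linarith
    · rw [heq, load_add_single hC, load_add_single hB]
      have h₁ := (dualFeasible_iff.1 hy).2 d
      have h₂ := min_le_left ε (y B)
      split_ifs with hdB hdC hdC
      · linarith
      · linarith
      · have hdB' : I.tail d ∈ B := by
          by_contra h'
          exact hdB ⟨h', hCB.1 hdC.2⟩
        linarith [h d (I.lt_of_enters hdC) ⟨hdB', hdC⟩]
      · linarith
  convert hfeas

/-! ### Restricting an optimum to the uncrossed cuts -/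

variable {R : Finset (Fin k)}

theorem load_uncrossedCuts_eq {d : ℕ}
    (ht : load I.tail I.head I.twoCuts y d = I.dcost d)
    (h : ∀ B ∈ I.twoCuts, Enters I.tail I.head d B → y B ≠ 0 → B ∈ I.uncrossedCuts R) :
    I.dcost d = load I.tail I.head (I.uncrossedCuts R) y d := by
  rw [← ht]
  refine (Finset.sum_subset (Finset.filter_subset_filter _ (uncrossedCuts_subset I R)) ?_).symm
  intro B hB hB'
  rw [Finset.mem_filter] at hB
  by_contra hne
  exact hB' (Finset.mem_filter.2 ⟨h B hB.1 hB.2 hne, hB.2⟩)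

/-- The restriction of a minimal laminar optimum to the cuts not crossed by `R` is optimal: its
value is the cost of a suitable cover. -/
theorem IsMinimalLaminarOptimum.exists_cover (hR : R ⊆ I.crossLinks)
    (hy : I.IsMinimalLaminarOptimum y) :
    ∃ F : Finset ℕ, (∀ C ∈ I.uncrossedCuts R, ∃ d ∈ F, Enters I.tail I.head d C) ∧
      ∑ d ∈ F, I.dcost d ≤ ∑ C ∈ I.uncrossedCuts R, y C := by
  classical
  obtain ⟨hopt, hmin, hlam⟩ := hy
  set U := I.uncrossedCuts R with hUdef
  have hU2 : ∀ C ∈ U, C ∈ I.twoCuts := uncrossedCuts_subset I R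
  have hU := I.isIntersecting_uncrossedCuts R
  have hinside : ∀ B ∈ I.twoCuts, y B ≠ 0 → ∀ C ∈ I.twoCuts, C ⊂ B → ∃ d, I.tail d ∈ B ∧
      Enters I.tail I.head d C ∧ load I.tail I.head I.twoCuts y d = I.dcost d :=
    fun B hB hyB C hC hCB => hmin.exists_tight hopt.1 hC hB hCB hyB
  have hsub : ∀ B ∈ I.twoCuts, y B ≠ 0 → ∀ C ⊆ B, ∀ d, I.tail d ∈ B →
      Enters I.tail I.head d C → ∀ A ∈ I.twoCuts, y A ≠ 0 → Enters I.tail I.head d A →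
      A ⊂ B := by
    intro B hB hyB C hCB d hdB hdC A hA hyA hdA
    rcases hlam A hA B hB hyA hyB with h | h | h
    · exact absurd (hCB hdC.2) (Finset.disjoint_left.1 h hdA.2)
    · exact ⟨h, fun h' => hdA.1 (h' hdB)⟩
    · exact absurd (h hdB) hdA.1
  have hlamS : ∀ A ∈ U.filter fun C => y C ≠ 0, ∀ B ∈ U.filter fun C => y C ≠ 0,
      Disjoint A B ∨ A ⊆ B ∨ B ⊆ A := by
    intro A hA B hB
    rw [Finset.mem_filter] at hA hB
    exact hlam A (hU2 A hA.1) B (hU2 B hB.1) hA.2 hB.2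
  have hT : ∀ C ∈ U, ∃ d ∈ {d | I.dcost d = load I.tail I.head U y d},
      Enters I.tail I.head d C := by
    intro C hC
    -- A tight link entering `C` stays tight on `U` unless it enters a support set outside `U`. If
    -- no such set meets `C`, optimality supplies the link. Otherwise take a minimal such `B`: it is
    -- not contained in `C`, as `U` is closed under smaller 2-cuts. Minimality of `y` then gives a
    -- tight link entering `C ∩ B` from within `B`, and the support sets it enters lie strictly
    -- inside `B`.
    by_cases hne : ∃ B ∈ I.twoCuts, B ∉ U ∧ y B ≠ 0 ∧ (C ∩ B).Nonempty
    · obtain ⟨B, hB⟩ := hne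
      obtain ⟨B, -, hBmin⟩ := (I.twoCuts.filter fun B => B ∉ U ∧ y B ≠ 0 ∧
        (C ∩ B).Nonempty).exists_le_minimal (Finset.mem_filter.2 hB)
      obtain ⟨hB2, hBU, hyB, hCB⟩ := Finset.mem_filter.1 hBmin.1
      have hI : C ∩ B ∈ I.twoCuts := by
        have hI₀ := I.isIntersecting_uncrossedCuts ∅
        rw [uncrossedCuts_empty] at hI₀
        exact (hI₀ C (hU2 C hC) B hB2 hCB).1
      have hIB : C ∩ B ⊂ B := by
        refine ⟨Finset.inter_subset_right, fun h => hBU ?_⟩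
        exact mem_uncrossedCuts_of_subset hR hC hB2 (h.trans Finset.inter_subset_left)
      obtain ⟨d, hdB, hd, ht⟩ := hinside B hB2 hyB _ hI hIB
      have hdC : Enters I.tail I.head d C :=
        ⟨fun h => hd.1 (Finset.mem_inter.2 ⟨h, hdB⟩), (Finset.mem_inter.1 hd.2).1⟩
      refine ⟨d, load_uncrossedCuts_eq ht fun A hA hdA hyA => ?_, hdC⟩
      by_contra hAU
      have hAB := hsub B hB2 hyB _ hIB.1 d hdB hd A hA hyA hdA
      exact hAB.2 (hBmin.2 (Finset.mem_filter.2
        ⟨hA, hAU, hyA, ⟨I.head d, Finset.mem_inter.2 ⟨hdC.2, hdA.2⟩⟩⟩) hAB.1)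
    · push Not at hne
      obtain ⟨d, hd, ht⟩ := hopt.exists_tight (hU2 C hC)
      refine ⟨d, load_uncrossedCuts_eq ht fun A hA hdA hyA => ?_, hd⟩
      by_contra hAU
      have : I.head d ∈ C ∩ A := Finset.mem_inter.2 ⟨hd.2, hdA.2⟩
      simp [hne A hA hAU hyA] at this
  have hM : ∀ B ∈ U.filter fun C => y C ≠ 0, ∀ C ∈ U, C ⊂ B →
      ∃ d ∈ {d | I.dcost d = load I.tail I.head U y d}, I.tail d ∈ B ∧
        Enters I.tail I.head d C := by
    intro B hB C hC hCB
    obtain ⟨hBU, hyB⟩ := Finset.mem_filter.1 hB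
    obtain ⟨d, hdB, hd, ht⟩ := hinside B (hU2 B hBU) hyB C (hU2 C hC) hCB
    refine ⟨d, load_uncrossedCuts_eq ht fun A hA hdA hyA => ?_, hdB, hd⟩
    -- All support sets entered by this link lie inside `B ∈ U`, so they belong to `U`.
    exact mem_uncrossedCuts_of_subset hR hBU hA
      (hsub B (hU2 B hBU) hyB C hCB.1 d hdB hd A hA hyA hdA).1
  obtain ⟨F, hFT, hFU, hF₁⟩ := exists_cover_of_laminar hU (Finset.filter_subset _ _) hlamS hT hM
  refine ⟨F, hFU, sum_cost_le_sum_of_tight (fun C hC => hopt.1.1 C (hU2 C hC)) F hFT ?_⟩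
  intro C hC hyC d hd d' hd'
  exact hF₁ C (Finset.mem_filter.2 ⟨hC, hyC⟩) d hd d' hd'

variable {q : ℕ} {C : ℕ → Finset V} {e : ℕ → ℕ} {val : ℕ → ℝ} {res : ℕ → ℝ}

/-- The greedy dual on `U` is feasible, so by weak duality it is at most the cost of the cover
constructed from `y`. -/
theorem _root_.IsGreedy.sum_val_le (hR : R ⊆ I.crossLinks)
    (h : IsGreedy I.tail I.head I.dcost (I.uncrossedCuts R) q C e val res)
    (hy : I.IsMinimalLaminarOptimum y) :
    ∑ i ∈ Finset.range q, val i ≤ ∑ A ∈ I.uncrossedCuts R, y A := by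
  obtain ⟨F, hF, hF'⟩ := hy.exists_cover hR
  rw [← h.sum_dual]
  refine (sum_le_sum_cost_of_cover (fun A _ => h.dual_nonneg A) (fun d => ?_) F id hF).trans hF'
  rw [h.load_dual]
  linarith [h.res_nonneg d]

/-- The greedy algorithm computes a minimal laminar optimum. -/
theorem _root_.IsGreedy.isMinimalLaminarOptimum
    (h : IsGreedy I.tail I.head I.dcost I.twoCuts q C e val res)
    (hcov : ∀ A ∈ I.twoCuts, ∃ i < q, Enters I.tail I.head (e i) A) {sel : ℕ → Prop}
    (hs : IsGreedy.Selects I.tail I.head q C e sel) :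
    I.IsMinimalLaminarOptimum (IsGreedy.dual q C val) := by
  classical
  have hU := I.isIntersecting_uncrossedCuts ∅
  rw [uncrossedCuts_empty] at hU
  have hload : ∀ d, load I.tail I.head I.twoCuts (IsGreedy.dual q C val) d ≤ I.dcost d := by
    intro d
    rw [h.load_dual]
    linarith [h.res_nonneg d]
  refine ⟨⟨dualFeasible_iff.2 ⟨fun A _ => h.dual_nonneg A, hload⟩, fun y' hy' => ?_⟩, ?_, ?_⟩
  · rw [h.sum_dual]
    rw [dualFeasible_iff] at hy'
    refine (sum_le_sum_cost_of_cover hy'.1 hy'.2 ((Finset.range q).filter sel) e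
      fun A hA => ?_).trans (hs.sum_cost_le h hU)
    obtain ⟨i, hi, hsi, hiA⟩ := hs.cover h hU hcov A hA
    exact ⟨i, Finset.mem_filter.2 ⟨Finset.mem_range.2 hi, hsi⟩, hiA⟩
  · intro ε hε A hA B hB hAB hfeas
    have hne : B ≠ A := fun h' => hAB.2 h'.le
    by_cases hz : IsGreedy.dual q C val B = 0
    · have := hfeas.1 B hB
      simp only [hz, if_true, if_neg hne] at this
      linarith
    · obtain ⟨i, hi, rfl⟩ := IsGreedy.exists_eq_of_dual_ne_zero hz
      -- When `C i` was processed, its subset `A` was already entered by a chosen link that does not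
      -- enter `C i`. This link is tight, so moving weight from `C i` to `A` violates its
      -- constraint.
      obtain ⟨j, hj, hjA⟩ := h.of_ssubset i hi A hA hAB
      have hjB : ¬ Enters I.tail I.head (e j) (C i) := h.not_enters i hi j hj
      have h₁ := (dualFeasible_iff.1 hfeas).2 (e j)
      have heq : (fun D => IsGreedy.dual q C val D - (if D = C i then ε else 0) +
          if D = A then ε else 0) = fun D => (IsGreedy.dual q C val D +
            if D = C i then -ε else 0) + if D = A then ε else 0 := by
        funext D
        split_ifs <;> ring
      have h₂ : load I.tail I.head I.twoCuts (fun D => (IsGreedy.dual q C val D +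
            if D = C i then -ε else 0) + if D = A then ε else 0) (e j) ≤ I.dcost (e j) := by
        rw [← heq]
        convert h₁
      rw [load_add_single hA, load_add_single hB, if_neg hjB, if_pos hjA, h.load_dual,
        h.res_zero j (hj.trans hi)] at h₂
      linarith
  · intro A hA B hB hyA hyB
    obtain ⟨i, hi, rfl⟩ := IsGreedy.exists_eq_of_dual_ne_zero hyA
    obtain ⟨j, hj, rfl⟩ := IsGreedy.exists_eq_of_dual_ne_zero hyB
    rw [or_iff_not_imp_left, Finset.not_disjoint_iff_nonempty_inter]
    intro hne
    rcases lt_trichotomy i j with hij | rfl | hij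
    · exact Or.inl (h.subset_of_lt hU hij hj (by rwa [Finset.inter_comm]))
    · exact Or.inl subset_rfl
    · exact Or.inr (h.subset_of_lt hU hij hi hne)

end Dual

end CacAP

/-! ### The program -/

namespace RAM

/-- The scalar stored in the first cell of the array `a`. -/
def NatExpr.var (a : ℕ) : NatExpr := .read a (.const 0)

@[simp] theorem NatExpr.eval_var (s : State) (a : ℕ) : (NatExpr.var a).eval s = s.nat a 0 := rfl

/-- The number of vertices. -/
def numV : NatExpr := .read 0 (.const 0)

/-- The number of edges. -/
def numE : NatExpr := .read 0 (.const 1)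

/-- The number of links. -/
def numL : NatExpr := .read 0 (.const 2)

/-- The number of directed links. -/
def numD : NatExpr := .add numL numL

/-- The root. -/
def rootE : NatExpr := .read 0 (.const 3)

/-- Exclusive disjunction of tests. -/
def Test.xor (b c : Test) : Test := .not (.and (.not (.and b (.not c))) (.not (.and c (.not b))))

theorem Test.holds_xor {s : State} {b c : Test} :
    (Test.xor b c).Holds s ↔ Xor (b.Holds s) (c.Holds s) := by
  simp only [Test.xor, Test.Holds, Xor]
  tauto

/-- The vertex `x` lies in the current cut: its label in array `7` differs from that of the
root. -/
def memT (x : NatExpr) : Test := .not (.natEq (.read 7 x) (.read 7 rootE))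

/-- The directed link `x` enters the current cut. -/
def entersT (x : NatExpr) : Test := .and (.not (memT (.read 10 x))) (memT (.read 11 x))

/-- Initialize the arrays `10`, `11`, `12` of tails, heads and underlying links of the directed
links, and the real array `1` of residual costs. -/
def initDirected : Prog :=
  .forTo 21 numL
    (.seq (.setNat 10 (.var 21) (.read 3 (.var 21)))
    (.seq (.setNat 11 (.var 21) (.read 4 (.var 21)))
    (.seq (.setNat 12 (.var 21) (.var 21))
    (.seq (.setReal 1 (.var 21) (.read 0 (.var 21)))
    (.seq (.setNat 10 (.add numL (.var 21)) (.read 4 (.var 21)))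
    (.seq (.setNat 11 (.add numL (.var 21)) (.read 3 (.var 21)))
    (.seq (.setNat 12 (.add numL (.var 21)) (.var 21))
    (.setReal 1 (.add numL (.var 21)) (.read 0 (.var 21))))))))))

/-- Replace the label stored in `32` by the one stored in `33`. -/
def relabel : Prog :=
  .forTo 25 numV
    (.ite (.natEq (.read 7 (.var 25)) (.var 32)) (.setNat 7 (.var 25) (.var 33)) .skip)

/-- Label the vertices such that two of them obtain the same label if and only if they are connected
without the edges stored in `22` and `23`. -/
def labels : Prog :=
  .seq (.forTo 25 numV (.setNat 7 (.var 25) (.var 25)))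
    (.forTo 24 numE
      (.ite (.and (.not (.natEq (.var 24) (.var 22))) (.not (.natEq (.var 24) (.var 23))))
        (.seq (.setNat 32 (.const 0) (.read 7 (.read 1 (.var 24))))
          (.seq (.setNat 33 (.const 0) (.read 7 (.read 2 (.var 24)))) relabel))
        .skip))

/-- Store the size of the current cut in `30`. -/
def size : Prog :=
  .seq (.setNat 30 (.const 0) (.const 0))
    (.forTo 25 numV
      (.ite (memT (.var 25)) (.setNat 30 (.const 0) (.add (.var 30) (.const 1))) .skip))

/-- Store in `31` whether a link in `R` crosses the current cut. -/
def crossed : Prog :=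
  .anyTo 31 24 numL
    (.and (.not (.natEq (.read 5 (.var 24)) (.const 0)))
      (.xor (memT (.read 3 (.var 24))) (memT (.read 4 (.var 24)))))

/-- Store in `29` whether a directed link chosen before enters the current cut. -/
def covered : Prog := .anyTo 29 24 (.var 20) (entersT (.read 16 (.var 24)))

/-- Store in `27` a directed link of minimal residual cost that enters the current cut. -/
def cheapest : Prog :=
  .seq (.setNat 28 (.const 0) (.const 0))
    (.forTo 24 numD
      -- Array `28` flags whether an entering link has been found. The test accepts the first one,
      -- and afterwards any that costs no more than the current choice.
      (.ite (.and (entersT (.var 24)) (.not (.and (.not (.natEq (.var 28) (.const 0)))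
          (.not (.realLe (.read 1 (.var 24)) (.read 1 (.var 27)))))))
        (.seq (.setNat 28 (.const 0) (.const 1)) (.setNat 27 (.const 0) (.var 24)))
        .skip))

/-- Raise the dual variable of the current cut. -/
def raise : Prog :=
  -- The amount is saved before the loop, which sets the residual cost of the chosen link itself to
  -- zero.
  .seq (.setReal 3 (.var 20) (.read 1 (.var 27)))
    (.forTo 24 numD
      (.ite (entersT (.var 24))
        (.setReal 1 (.var 24) (.sub (.read 1 (.var 24)) (.read 3 (.var 20)))) .skip))

/-- Record the current cut and the chosen directed link. -/
def record : Prog :=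
  .seq (.setNat 14 (.var 20) (.var 22))
  (.seq (.setNat 15 (.var 20) (.var 23))
  (.seq (.setNat 16 (.var 20) (.var 27))
  (.setNat 20 (.const 0) (.add (.var 20) (.const 1)))))

/-- Process the cut given by the edges stored in `22` and `23` if its size is the one stored
in `21`. -/
def round : Prog :=
  .seq labels (.seq size (.seq crossed (.seq covered
    -- A nonempty separated set is automatically a 2-cut, so only nonemptiness is tested. A cut that
    -- arises from several pairs of edges is skipped later because it is then covered.
    (.ite (.and (.natEq (.var 29) (.const 0)) (.and (.natEq (.var 30) (.var 21))
        (.and (.natEq (.var 31) (.const 0)) (.natLe (.const 1) (.var 30)))))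
      (.seq cheapest (.seq raise record)) .skip))))

/-- The greedy phase. -/
def greedy : Prog :=
  .forTo 21 (.add numV (.const 1)) (.forTo 22 numE (.forTo 23 numE round))

/-- Decide whether to select the directed link of the round `26` of the greedy phase. -/
def selectRound : Prog :=
  .seq (.setNat 26 (.const 0) (.sub (.sub (.var 20) (.const 1)) (.var 21)))
  (.seq (.setNat 22 (.const 0) (.read 14 (.var 26)))
  (.seq (.setNat 23 (.const 0) (.read 15 (.var 26)))
  (.seq labels
  (.seq (.anyTo 29 24 (.var 20)
    (.and (.not (.natEq (.read 17 (.var 24)) (.const 0))) (entersT (.read 16 (.var 24)))))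
  (.ite (.natEq (.var 29) (.const 0))
    (.seq (.setNat 17 (.var 26) (.const 1))
      (.setNat 6 (.read 12 (.read 16 (.var 26))) (.const 1)))
    .skip)))))

/-- The selection phase. -/
def select : Prog := .forTo 21 (.var 20) selectRound

/-- The algorithm. -/
def algorithm : Prog := .seq initDirected (.seq greedy select)

/-! ### Reading the instance -/

variable {n m k : ℕ}

/-- The memory content `s` holds the instance `I` and the set `R`. -/
structure Holds (I : CacAP (Fin n) (Fin m) (Fin k)) (R : Finset (Fin k)) (s : State) : Prop where
  numV : s.nat 0 0 = n
  numE : s.nat 0 1 = m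
  numL : s.nat 0 2 = k
  root : s.nat 0 3 = I.root
  fst : ∀ g : Fin m, s.nat 1 g = I.graph.fst g
  snd : ∀ g : Fin m, s.nat 2 g = I.graph.snd g
  linkFst : ∀ ℓ : Fin k, s.nat 3 ℓ = I.links.fst ℓ
  linkSnd : ∀ ℓ : Fin k, s.nat 4 ℓ = I.links.snd ℓ
  chosen : ∀ ℓ : Fin k, s.nat 5 ℓ = 0 ↔ ℓ ∉ R

variable {I : CacAP (Fin n) (Fin m) (Fin k)} {R : Finset (Fin k)} {s s' : State} {N : ℕ}

theorem holds_input : Holds I R (I.input R) where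
  numV := by simp [CacAP.input, pad]
  numE := by simp [CacAP.input, pad]
  numL := by simp [CacAP.input, pad]
  root := by simp [CacAP.input, pad]
  fst g := by simp [CacAP.input, pad]
  snd g := by simp [CacAP.input, pad]
  linkFst ℓ := by simp [CacAP.input, pad]
  linkSnd ℓ := by simp [CacAP.input, pad]
  chosen ℓ := by simp [CacAP.input, pad]

theorem Holds.congr (h : Holds I R s) (hs : ∀ a < 6, s'.nat a = s.nat a) : Holds I R s' where
  numV := by rw [hs 0 (by norm_num), h.numV]
  numE := by rw [hs 0 (by norm_num), h.numE]
  numL := by rw [hs 0 (by norm_num), h.numL]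
  root := by rw [hs 0 (by norm_num), h.root]
  fst g := by rw [hs 1 (by norm_num), h.fst]
  snd g := by rw [hs 2 (by norm_num), h.snd]
  linkFst ℓ := by rw [hs 3 (by norm_num), h.linkFst]
  linkSnd ℓ := by rw [hs 4 (by norm_num), h.linkSnd]
  chosen ℓ := by rw [hs 5 (by norm_num), h.chosen]

theorem Holds.setNat (h : Holds I R s) {a : ℕ} (ha : 6 ≤ a) (i x : ℕ) :
    Holds I R (s.setNat a i x) :=
  h.congr fun b hb => State.setNat_nat_of_ne _ _ _ (by omega)

theorem Holds.setReal (h : Holds I R s) (a i : ℕ) (x : ℝ) : Holds I R (s.setReal a i x) :=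
  h.congr fun _ _ => rfl

theorem Holds.frame (h : Holds I R s) {P : Prog} (hf : P.Frame s s')
    (hP : ∀ a < 6, P.writesNat a = false) : Holds I R s' :=
  h.congr fun a ha => hf.nat a (hP a ha)

/-- The memory content `s` holds the directed links. -/
def Directed (I : CacAP (Fin n) (Fin m) (Fin k)) (s : State) : Prop :=
  ∀ d < k + k, s.nat 10 d = I.tail d ∧ s.nat 11 d = I.head d ∧
    s.nat 12 d = if d < k then d else d - k

theorem Directed.congr (h : Directed I s) (h₀ : s'.nat 10 = s.nat 10) (h₁ : s'.nat 11 = s.nat 11)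
    (h₂ : s'.nat 12 = s.nat 12) : Directed I s' := by
  intro d hd
  rw [h₀, h₁, h₂]
  exact h d hd

/-- Both the residual array and `I.dcost` vanish from `2 k` on, which allows an equality of
functions. -/
theorem ok_initDirected (h : Holds I R s) (hk : k ≤ N) (hreal : s.real 1 = fun _ => 0)
    (hcost : ∀ ℓ : Fin k, s.real 0 ℓ = I.cost ℓ) :
    initDirected.Ok N s fun s' => Directed I s' ∧ s'.real 1 = I.dcost := by
  let Done (i d : ℕ) : Prop := d < i ∨ (k ≤ d ∧ d < k + i)
  refine Prog.Ok.mono' (ok_forTo (M := k) (fun i s' => ∀ d,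
    (Done i d → s'.nat 10 d = I.tail d ∧ s'.nat 11 d = I.head d ∧
      (s'.nat 12 d = if d < k then d else d - k) ∧ s'.real 1 d = I.dcost d) ∧
    (¬ Done i d → s'.real 1 d = 0)) hk rfl ?_ ?_ ?_) ?_
  · intro s' hf
    exact (h.frame hf (by decide)).numL
  · intro d
    refine ⟨fun hd => ?_, fun _ => ?_⟩
    · simp only [Done] at hd
      omega
    · simp [hreal]
  · intro i hi s' hf hc hI
    have h' := h.frame hf (by decide)
    have h0 : s'.real 0 = s.real 0 := hf.real 0 rfl
    have h₁ := h'.linkFst ⟨i, hi⟩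
    have h₂ := h'.linkSnd ⟨i, hi⟩
    have h₃ := h'.numL
    have h₄ := hcost ⟨i, hi⟩
    simp only at h₁ h₂ h₄
    refine ok_seq (ok_setNat (ok_seq (ok_setNat (ok_seq (ok_setNat (ok_seq (ok_setReal (ok_seq
      (ok_setNat (ok_seq (ok_setNat (ok_seq (ok_setNat (ok_setReal ?_))))))))))))))
    intro d
    obtain ⟨hI₁, hI₂⟩ := hI d
    have hk0 : k ≠ 0 := by omega
    by_cases hdi : d = i
    · subst hdi
      simp [NatExpr.eval, RealExpr.eval, numL, hc, h₁, h₂, h₃, h0, h₄, hi,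
        CacAP.tail, CacAP.head, CacAP.dcost, pad, Done, hk0]
    by_cases hdk : d = k + i
    · subst hdk
      simp [NatExpr.eval, RealExpr.eval, numL, hc, h₁, h₂, h₃, h0, h₄, hi,
        CacAP.tail, CacAP.head, CacAP.dcost, pad, Done, hk0]
    have hD : Done (i + 1) d ↔ Done i d := by
      simp only [Done]
      omega
    rw [hD]
    simpa [NatExpr.eval, RealExpr.eval, numL, hc, h₁, h₂, h₃, h0, Function.update_apply, hdi, hdk]
      using ⟨hI₁, hI₂⟩
  · intro s' hf hI
    refine ⟨fun d hd => ?_, funext fun d => ?_⟩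
    · have := (hI d).1 (by simp only [Done]; omega)
      exact ⟨this.1, this.2.1, this.2.2.1⟩
    · by_cases hd : d < k + k
      · exact ((hI d).1 (by simp only [Done]; omega)).2.2.2
      · rw [(hI d).2 (by simp only [Done]; omega)]
        have h₁ : ¬ d < k := by omega
        have h₂ : ¬ d - k < k := by omega
        simp [CacAP.dcost, pad, h₁, h₂]

/-! ### The current cut -/

/-- The current cut. -/
def side (I : CacAP (Fin n) (Fin m) (Fin k)) (s : State) : Finset (Fin n) :=
  Finset.univ.filter fun v => s.nat 7 v ≠ s.nat 7 I.root

theorem side_congr (h : s'.nat 7 = s.nat 7) : side I s' = side I s := by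
  simp [side, h]

theorem holds_memT (h : Holds I R s) {x : NatExpr} {v : Fin n} (hx : x.eval s = v) :
    (memT x).Holds s ↔ v ∈ side I s := by
  simp [memT, Test.Holds, NatExpr.eval, side, hx, rootE, h.root]

theorem holds_entersT (h : Holds I R s) (hd : Directed I s) {x : NatExpr} {d : ℕ}
    (hx : x.eval s = d) (hdk : d < k + k) :
    (entersT x).Holds s ↔ Enters I.tail I.head d (side I s) := by
  obtain ⟨h₁, h₂, -⟩ := hd d hdk
  rw [entersT, Test.Holds, Test.Holds, holds_memT h (v := I.tail d) (by simp [NatExpr.eval, hx, h₁]),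
    holds_memT h (v := I.head d) (by simp [NatExpr.eval, hx, h₂])]
  rfl

/-- The labelling after the edges with numbers less than `i`, except `e` and `f`, have been
contracted. -/
structure IsLabelling (I : CacAP (Fin n) (Fin m) (Fin k)) (e f i : ℕ) (lab : ℕ → ℕ) : Prop where
  eq_of_edge : ∀ g : Fin m, (g : ℕ) < i → (g : ℕ) ≠ e → (g : ℕ) ≠ f →
    lab (I.graph.fst g) = lab (I.graph.snd g)
  mem_iff : ∀ D : Finset (Fin n), (∀ g ∈ I.graph.boundary D, (g : ℕ) = e ∨ (g : ℕ) = f) →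
    ∀ u v : Fin n, lab u = lab v → (u ∈ D ↔ v ∈ D)

/-- Merging the two classes of an edge other than `e` and `f` is harmless: its ends are on the same
side of every set `D` whose boundary lies in this pair. -/
theorem IsLabelling.succ {e f : ℕ} {g : Fin m} {lab lab' : ℕ → ℕ}
    (h : IsLabelling I e f g lab) (he : (g : ℕ) ≠ e) (hf : (g : ℕ) ≠ f)
    (hlab : ∀ v : Fin n, lab' v = if lab v = lab (I.graph.fst g) then lab (I.graph.snd g)
      else lab v) : IsLabelling I e f (g + 1) lab' where
  eq_of_edge g' hg' he' hf' := by
    rw [hlab, hlab]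
    rcases Nat.lt_succ_iff_lt_or_eq.1 hg' with hlt | heq
    · rw [h.eq_of_edge g' hlt he' hf']
    · obtain rfl := Fin.ext heq
      simp
  mem_iff D hD u v huv := by
    have hg : I.graph.fst g ∈ D ↔ I.graph.snd g ∈ D := by
      have : g ∉ I.graph.boundary D := fun h' => (hD g h').elim he hf
      rw [Multigraph.mem_boundary] at this
      unfold Xor at this
      tauto
    rw [hlab, hlab] at huv
    have := h.mem_iff D hD
    split_ifs at huv with h₁ h₂ h₂
    · rw [this _ _ h₁, this _ _ h₂]
    · rw [this _ _ h₁, hg, this _ _ huv]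
    · rw [this _ _ huv, this _ _ h₂, hg]
    · exact this _ _ huv

theorem IsLabelling.skip {e f : ℕ} {g : ℕ} {lab : ℕ → ℕ}
    (h : IsLabelling I e f g lab) (hg : g = e ∨ g = f) : IsLabelling I e f (g + 1) lab where
  eq_of_edge g' hg' he' hf' := by
    refine h.eq_of_edge g' ?_ he' hf'
    omega
  mem_iff := h.mem_iff

/-- The set of vertices labelled differently from the root is itself one of the sets in the union
defining `separated`, and it contains all the others. -/
theorem IsLabelling.side_eq {e f : ℕ} (h : IsLabelling I e f m (s.nat 7)) :
    side I s = I.graph.separated I.root e f := by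
  ext v
  rw [Multigraph.mem_separated]
  constructor
  · intro hv
    refine ⟨side I s, by simp [side], hv, fun g hg => ?_⟩
    by_contra! hne
    have := h.eq_of_edge g g.2 hne.1 hne.2
    rw [Multigraph.mem_boundary] at hg
    simp [side, this, Xor] at hg
  · rintro ⟨D, hr, hv, hD⟩
    simp only [side, Finset.mem_filter, Finset.mem_univ, true_and]
    intro heq
    exact hr ((h.mem_iff D hD _ _ heq).1 hv)

theorem ok_labels (h : Holds I R s) (hn : n ≤ N) (hm : m ≤ N) :
    labels.Ok N s fun s' =>
      side I s' = I.graph.separated I.root (s.nat 22 0) (s.nat 23 0) := by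
  refine ok_seq' (Q₁ := fun s' => ∀ v < n, s'.nat 7 v = v)
    (ok_forTo (fun i s' => ∀ v < i, s'.nat 7 v = v) hn rfl ?_ ?_ ?_) ?_
  · exact fun s' hf => (h.frame hf (by decide)).numV
  · simp
  · intro i hi s' hf hc hI
    refine ok_setNat fun v hv => ?_
    by_cases hvi : v = i
    · simp [hvi, hc]
    · simp [hvi, hc, hI v (by omega)]
  intro s₁ hf₁ hs₁
  have h₁ := h.frame hf₁ (by decide)
  set e := s.nat 22 0 with he
  set f := s.nat 23 0 with hf
  have he₁ : s₁.nat 22 0 = e := by rw [hf₁.nat 22 rfl]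
  have hf₁ : s₁.nat 23 0 = f := by rw [hf₁.nat 23 rfl]
  refine Prog.Ok.mono' (ok_forTo (fun i s' => IsLabelling I e f i (s'.nat 7)) hm rfl ?_ ?_ ?_)
    fun s' _ hI => hI.side_eq
  · exact fun s' hf => (h₁.frame hf (by decide)).numE
  · refine ⟨by simp, fun D _ u v huv => ?_⟩
    rw [State.setNat_nat_of_ne _ _ _ (by norm_num), hs₁ u u.2, hs₁ v v.2] at huv
    rw [Fin.ext huv]
  · intro i hi s₂ hf₂ hc hI
    have h₂ := h₁.frame hf₂ (by decide)
    have hfst := h₂.fst ⟨i, hi⟩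
    have hsnd := h₂.snd ⟨i, hi⟩
    simp only at hfst hsnd
    have he₂ : s₂.nat 22 0 = e := by rw [hf₂.nat 22 rfl, he₁]
    have hf₂ : s₂.nat 23 0 = f := by rw [hf₂.nat 23 rfl, hf₁]
    refine ok_ite (fun hb => ?_) fun hb => ok_skip ?_
    · simp only [Test.Holds, Test.holds_natEq, NatExpr.eval_var, hc, he₂, hf₂] at hb
      -- Both labels are copied first, because relabelling overwrites the entries they are read
      -- from.
      refine ok_seq (ok_setNat (ok_seq (ok_setNat ?_)))
      set s₃ := (s₂.setNat 32 _ _).setNat 33 _ _ with hs₃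
      have h₃ : Holds I R s₃ := (h₂.setNat (by norm_num) _ _).setNat (by norm_num) _ _
      have h7 : s₃.nat 7 = s₂.nat 7 := by simp [hs₃]
      have h32 : s₃.nat 32 0 = s₂.nat 7 (I.graph.fst ⟨i, hi⟩) := by
        simp [hs₃, NatExpr.eval, hc, hfst]
      have h33 : s₃.nat 33 0 = s₂.nat 7 (I.graph.snd ⟨i, hi⟩) := by
        simp [hs₃, NatExpr.eval, hc, hsnd]
      refine Prog.Ok.mono' (ok_forTo (fun j s' => ∀ v, s'.nat 7 v =
        if v < j ∧ s₂.nat 7 v = s₂.nat 7 (I.graph.fst ⟨i, hi⟩)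
        then s₂.nat 7 (I.graph.snd ⟨i, hi⟩) else s₂.nat 7 v) hn rfl ?_ ?_ ?_) ?_
      · exact fun s' hf => (h₃.frame hf (by decide)).numV
      · simp [h7]
      · intro j hj s₄ hf₄ hc₄ hI₄
        have h32' : s₄.nat 32 0 = _ := (congrFun (hf₄.nat 32 rfl) 0).trans h32
        have h33' : s₄.nat 33 0 = _ := (congrFun (hf₄.nat 33 rfl) 0).trans h33
        refine ok_ite (fun hb' => ok_setNat fun v => ?_) fun hb' => ok_skip fun v => ?_ <;>
          simp only [Test.holds_natEq, NatExpr.eval, NatExpr.eval_var, hc₄, h32', hI₄ j,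
            lt_irrefl, false_and, if_false] at hb'
        · by_cases hvj : v = j
          · simp [hvj, hc₄, h33', hb']
          · have : v < j + 1 ↔ v < j := by omega
            simp [hvj, hc₄, hI₄ v, this]
        · by_cases hvj : v = j
          · simp [hvj, hI₄ j, hb']
          · have : v < j + 1 ↔ v < j := by omega
            simp [hI₄ v, this]
      · intro s₄ _ hI₄
        rw [State.setNat_nat_of_ne _ _ _ (by norm_num)]
        refine IsLabelling.succ (g := ⟨i, hi⟩) hI hb.1 hb.2 fun v => ?_
        simpa using hI₄ v
    · simp only [Test.Holds, Test.holds_natEq, NatExpr.eval_var, hc, he₂, hf₂] at hb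
      rw [State.setNat_nat_of_ne _ _ _ (by norm_num)]
      exact hI.skip (by tauto)

theorem ok_size (h : Holds I R s) (hn : n ≤ N) :
    size.Ok N s fun s' => s'.nat 30 0 = (side I s).card := by
  refine ok_seq (ok_setNat ?_)
  have h₁ := h.setNat (a := 30) (by norm_num) 0 0
  refine Prog.Ok.mono' (ok_forTo (fun i s' => s'.nat 30 0 =
    ((side I s).filter fun v : Fin n => (v : ℕ) < i).card) hn rfl ?_ ?_ ?_) ?_
  · exact fun s' hf => (h₁.frame hf (by decide)).numV
  · simp [NatExpr.eval]
  · intro i hi s₂ hf₂ hc hI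
    have h₂ := h₁.frame hf₂ (by decide)
    have hside : side I s₂ = side I s := by
      refine side_congr ?_
      rw [hf₂.nat 7 rfl]
      simp
    have hmem := holds_memT h₂ (x := .var 25) (v := ⟨i, hi⟩) (by simp [hc])
    rw [hside] at hmem
    refine ok_ite (fun hb => ok_setNat ?_) fun hb => ok_skip ?_
    · have : (side I s).filter (fun v : Fin n => (v : ℕ) < i + 1) =
          insert ⟨i, hi⟩ ((side I s).filter fun v : Fin n => (v : ℕ) < i) := by
        ext v
        simp only [Finset.mem_filter, Finset.mem_insert, Nat.lt_succ_iff_lt_or_eq, Fin.ext_iff]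
        constructor
        · tauto
        · rintro (h' | h')
          · obtain rfl : v = ⟨i, hi⟩ := Fin.ext h'
            exact ⟨hmem.1 hb, Or.inr rfl⟩
          · tauto
      rw [this, Finset.card_insert_of_notMem (by simp), ← hI]
      simp [NatExpr.eval]
    · have : (side I s).filter (fun v : Fin n => (v : ℕ) < i + 1) =
          (side I s).filter fun v : Fin n => (v : ℕ) < i := by
        refine Finset.filter_congr fun v hv => ?_
        have : (v : ℕ) ≠ i := fun h' => hb (hmem.2 (by
          obtain rfl : v = ⟨i, hi⟩ := Fin.ext h'
          exact hv))
        omega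
      rw [this, ← hI]
      simp
  · intro s' _ hI
    rw [hI, Finset.filter_true_of_mem fun v _ => v.2]

theorem ok_crossed (h : Holds I R s) (hk : k ≤ N) :
    crossed.Ok N s fun s' => s'.nat 31 0 = 0 ↔ ∀ ℓ ∈ R, ℓ ∉ I.links.boundary (side I s) := by
  refine Prog.Ok.mono' (ok_anyTo (fun i => ∃ ℓ : Fin k, (ℓ : ℕ) = i ∧ ℓ ∈ R ∧
    ℓ ∈ I.links.boundary (side I s)) hk (by norm_num) ?_ ?_) ?_
  · exact fun s' hf => (h.frame hf (by decide)).numL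
  · intro i hi s' hf hc
    have h' := h.frame hf (by decide)
    have h₁ := h'.linkFst ⟨i, hi⟩
    have h₂ := h'.linkSnd ⟨i, hi⟩
    have h₃ := h'.chosen ⟨i, hi⟩
    simp only at h₁ h₂ h₃
    rw [Test.Holds, Test.Holds, Test.holds_natEq, Test.holds_xor,
      holds_memT h' (v := I.links.fst ⟨i, hi⟩) (by simp [NatExpr.eval, hc, h₁]),
      holds_memT h' (v := I.links.snd ⟨i, hi⟩) (by simp [NatExpr.eval, hc, h₂]),
      side_congr (hf.nat 7 rfl), ← Multigraph.mem_boundary]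
    simp only [NatExpr.eval, NatExpr.eval_var, hc, h₃, not_not]
    constructor
    · exact fun h => ⟨⟨i, hi⟩, rfl, h⟩
    · rintro ⟨ℓ, rfl, h⟩
      exact h
  · intro s' _ hs'
    rw [hs']
    constructor
    · intro h' ℓ hℓ hℓ'
      exact h' ℓ ℓ.2 ⟨ℓ, rfl, hℓ, hℓ'⟩
    · rintro h' i - ⟨ℓ, -, hℓ, hℓ'⟩
      exact h' ℓ hℓ hℓ'

end RAM

namespace RAM

variable {n m k : ℕ} {I : CacAP (Fin n) (Fin m) (Fin k)} {R : Finset (Fin k)} {s s' : State}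
  {N : ℕ}

/-! ### The greedy phase -/

/-- The arrays of natural numbers that hold the instance and the state of the greedy phase. -/
def mainArrays : List ℕ := [0, 1, 2, 3, 4, 5, 10, 11, 12, 14, 15, 16, 20]

/-- The memory contents agree on the instance and the state of the greedy phase. -/
structure Same (s s' : State) : Prop where
  nat : ∀ a ∈ mainArrays, s'.nat a = s.nat a
  real_one : s'.real 1 = s.real 1
  real_three : s'.real 3 = s.real 3

theorem Same.trans {s'' : State} (h : Same s s') (h' : Same s' s'') : Same s s'' :=
  ⟨fun a ha => (h'.nat a ha).trans (h.nat a ha), h'.real_one.trans h.real_one,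
    h'.real_three.trans h.real_three⟩

theorem Prog.Frame.same {P : Prog} (h : P.Frame s s')
    (hn : ∀ a ∈ mainArrays, P.writesNat a = false) (h₁ : P.writesReal 1 = false)
    (h₃ : P.writesReal 3 = false) : Same s s' :=
  ⟨fun a ha => h.nat a (hn a ha), h.real 1 h₁, h.real 3 h₃⟩

theorem same_setNat {a : ℕ} (ha : a ∉ mainArrays) (i x : ℕ) : Same s (s.setNat a i x) :=
  ⟨fun _ hb => State.setNat_nat_of_ne _ _ _ fun h => ha (h ▸ hb), rfl, rfl⟩

theorem Holds.same (h : Holds I R s) (hs : Same s s') : Holds I R s' :=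
  h.congr fun a ha => hs.nat a (by
    revert a
    decide)

theorem Directed.same (h : Directed I s) (hs : Same s s') : Directed I s' :=
  h.congr (hs.nat 10 (by decide)) (hs.nat 11 (by decide)) (hs.nat 12 (by decide))

/-- The cut processed in round `i`. -/
noncomputable def cutAt (I : CacAP (Fin n) (Fin m) (Fin k)) (s : State) (i : ℕ) : Finset (Fin n) :=
  I.graph.separated I.root (s.nat 14 i) (s.nat 15 i)

/-- A directed link chosen so far enters `A`. -/
def Covered (I : CacAP (Fin n) (Fin m) (Fin k)) (s : State) (A : Finset (Fin n)) : Prop :=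
  ∃ i < s.nat 20 0, Enters I.tail I.head (s.nat 16 i) A

theorem cutAt_same (hs : Same s s') : cutAt I s' = cutAt I s := by
  funext i
  rw [cutAt, cutAt, hs.nat 14 (by decide), hs.nat 15 (by decide)]

theorem covered_same (hs : Same s s') {A : Finset (Fin n)} : Covered I s' A ↔ Covered I s A := by
  rw [Covered, Covered, hs.nat 16 (by decide), hs.nat 20 (by decide)]

/-- The memory content `s` holds the instance and the state of the greedy phase. -/
structure GreedyState (I : CacAP (Fin n) (Fin m) (Fin k)) (R : Finset (Fin k)) (s : State) :
    Prop where
  holds : Holds I R s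
  directed : Directed I s
  greedy : IsGreedy I.tail I.head I.dcost (I.uncrossedCuts R) (s.nat 20 0) (cutAt I s) (s.nat 16)
    (s.real 3) (s.real 1)

theorem GreedyState.same (h : GreedyState I R s) (hs : Same s s') : GreedyState I R s' where
  holds := h.holds.same hs
  directed := h.directed.same hs
  greedy := by
    rw [cutAt_same hs, hs.nat 20 (by decide), hs.nat 16 (by decide), hs.real_one, hs.real_three]
    exact h.greedy

theorem GreedyState.lt (h : GreedyState I R s) {i : ℕ} (hi : i < s.nat 20 0) :
    s.nat 16 i < k + k := I.lt_of_enters (h.greedy.enters i hi)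

/-- Chosen directed links are distinct. This bounds the loops over previous rounds. -/
theorem GreedyState.le (h : GreedyState I R s) : s.nat 20 0 ≤ k + k := by
  have := Finset.card_le_card_of_injOn (s := Finset.range (s.nat 20 0))
    (t := Finset.range (k + k)) (s.nat 16)
    (fun i hi => Finset.mem_coe.2 (Finset.mem_range.2 (h.lt (Finset.mem_range.1 hi))))
    (fun i hi j hj hij => h.greedy.injOn (Finset.mem_range.1 hi) (Finset.mem_range.1 hj) hij)
  simpa using this

theorem ok_covered (h : GreedyState I R s) (hk : k + k ≤ N) :
    covered.Ok N s fun s' => s'.nat 29 0 = 0 ↔ ¬ Covered I s (side I s) := by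
  refine Prog.Ok.mono' (ok_anyTo (fun i => Enters I.tail I.head (s.nat 16 i) (side I s))
    (h.le.trans hk) (by norm_num) ?_ ?_) ?_
  · intro s' hf
    rw [NatExpr.eval_var, hf.nat 20 rfl]
  · intro i hi s' hf hc
    have hs : Same s s' := hf.same (by decide) rfl rfl
    rw [holds_entersT (h.holds.same hs) (h.directed.same hs) (d := s.nat 16 i) ?_ (h.lt hi),
      side_congr (hf.nat 7 rfl)]
    rw [NatExpr.eval, NatExpr.eval_var, hc, hf.nat 16 rfl]
  · intro s' _ hs'
    rw [hs', Covered]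
    push Not
    rfl

theorem ok_cheapest (h : Holds I R s) (hd : Directed I s) (hk : k + k ≤ N)
    (hex : ∃ d, Enters I.tail I.head d (side I s)) :
    cheapest.Ok N s fun s' => Enters I.tail I.head (s'.nat 27 0) (side I s) ∧
      ∀ d, Enters I.tail I.head d (side I s) → s.real 1 (s'.nat 27 0) ≤ s.real 1 d := by
  refine ok_seq (ok_setNat ?_)
  have hs₁ : Same s (s.setNat 28 0 0) := same_setNat (by decide) _ _
  refine Prog.Ok.mono' (ok_forTo (M := k + k) (fun i s' =>
    (s'.nat 28 0 = 0 ∧ ∀ d < i, ¬ Enters I.tail I.head d (side I s)) ∨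
    (s'.nat 28 0 ≠ 0 ∧ Enters I.tail I.head (s'.nat 27 0) (side I s) ∧
      ∀ d < i, Enters I.tail I.head d (side I s) → s.real 1 (s'.nat 27 0) ≤ s.real 1 d))
    hk rfl ?_ ?_ ?_) ?_
  · intro s' hf
    have := (h.same (hs₁.trans (hf.same (by decide) rfl rfl))).numL
    simp [numD, numL, NatExpr.eval, this]
  · exact Or.inl ⟨by simp [NatExpr.eval], by simp⟩
  · intro i hi s₂ hf hc hI
    have hs₂ : Same s s₂ := hs₁.trans (hf.same (by decide) rfl rfl)
    have hside : side I s₂ = side I s := by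
      refine side_congr ?_
      rw [hf.nat 7 rfl]
      simp
    have hent := holds_entersT (h.same hs₂) (hd.same hs₂) (x := .var 24) (d := i)
      (by simp [hc]) hi
    rw [hside] at hent
    have hreal := hs₂.real_one
    refine ok_ite (fun hb => ok_seq (ok_setNat (ok_setNat ?_))) fun hb => ok_skip ?_ <;>
      simp only [Test.Holds, hent, Test.holds_natEq, NatExpr.eval, NatExpr.eval_var,
        RealExpr.eval, hc, hreal, not_and_or, not_not] at hb
    · refine Or.inr ⟨by simp [NatExpr.eval], by simpa [hc, NatExpr.eval] using hb.1, fun d hdi hd => ?_⟩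
      simp only [NatExpr.eval_var, State.setNat_nat_self, Function.update_self, NatExpr.eval,
        ne_eq, Nat.reduceEqDiff, not_false_eq_true, State.setNat_nat_of_ne, hc]
      rcases Nat.lt_succ_iff_lt_or_eq.1 hdi with hdi | rfl
      · rcases hI with ⟨-, hI⟩ | ⟨hI₀, hI₁, hI₂⟩
        · exact absurd hd (hI d hdi)
        · exact (hb.2.resolve_left hI₀).trans (hI₂ d hdi hd)
      · exact le_rfl
    · simp only [ne_eq, Nat.reduceEqDiff, not_false_eq_true, State.setNat_nat_of_ne]
      rcases hI with ⟨hI₀, hI⟩ | ⟨hI₀, hI₁, hI₂⟩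
      · refine Or.inl ⟨hI₀, fun d hdi hd => ?_⟩
        rcases Nat.lt_succ_iff_lt_or_eq.1 hdi with hdi | rfl
        · exact hI d hdi hd
        · rcases hb with hb | hb
          exacts [hb hd, hb (Or.inl hI₀)]
      · refine Or.inr ⟨hI₀, hI₁, fun d hdi hd => ?_⟩
        rcases Nat.lt_succ_iff_lt_or_eq.1 hdi with hdi | rfl
        · exact hI₂ d hdi hd
        · rcases hb with hb | hb
          exacts [absurd hd hb, (not_le.1 fun h' => hb (Or.inr h')).le]
  · rintro s' - (⟨-, hI⟩ | ⟨-, hI₁, hI₂⟩)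
    · obtain ⟨d, hd⟩ := hex
      exact absurd hd (hI d (I.lt_of_enters hd))
    · exact ⟨hI₁, fun d hd => hI₂ d (I.lt_of_enters hd) hd⟩

theorem ok_raise (h : Holds I R s) (hd : Directed I s) (hk : k + k ≤ N) :
    raise.Ok N s fun s' =>
      s'.real 3 = Function.update (s.real 3) (s.nat 20 0) (s.real 1 (s.nat 27 0)) ∧
      ∀ d, s'.real 1 d = if Enters I.tail I.head d (side I s)
        then s.real 1 d - s.real 1 (s.nat 27 0) else s.real 1 d := by
  refine ok_seq (ok_setReal ?_)
  set s₁ := s.setReal 3 _ _ with hs₁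
  have h₁ : Holds I R s₁ := h.setReal _ _ _
  have h3 : s₁.real 3 = Function.update (s.real 3) (s.nat 20 0) (s.real 1 (s.nat 27 0)) := by
    simp [hs₁, RealExpr.eval]
  refine Prog.Ok.mono' (ok_forTo (M := k + k) (fun i s' =>
    ∀ d, s'.real 1 d = if d < i ∧ Enters I.tail I.head d (side I s)
        then s.real 1 d - s.real 1 (s.nat 27 0) else s.real 1 d) hk rfl ?_ ?_ ?_) ?_
  · intro s' hf
    have := (h₁.frame hf (by decide)).numL
    simp [numD, numL, NatExpr.eval, this]
  · intro d
    simp [hs₁]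
  · intro i hi s₂ hf hc hI
    have hside : side I s₂ = side I s := side_congr (hf.nat 7 rfl)
    have hent := holds_entersT (h₁.frame hf (by decide))
      (hd.congr (hf.nat 10 rfl) (hf.nat 11 rfl) (hf.nat 12 rfl)) (x := .var 24) (d := i)
      (by simp [hc]) hi
    rw [hside] at hent
    have h20 : s₂.nat 20 0 = s.nat 20 0 := congrFun (hf.nat 20 rfl) 0
    have h3' : s₂.real 3 (s.nat 20 0) = s.real 1 (s.nat 27 0) := by
      rw [hf.real 3 rfl, h3, Function.update_self]
    refine ok_ite (fun hb => ok_setReal fun d => ?_) fun hb => ok_skip fun d => ?_ <;>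
      rw [hent] at hb
    · by_cases hdi : d = i
      · subst hdi
        simp [RealExpr.eval, hc, h20, h3', hb, hI d]
      · have : d < i + 1 ↔ d < i := by omega
        simp [hc, hdi, hI d, this]
    · by_cases hdi : d = i
      · subst hdi
        simp [hb, hI d]
      · have : d < i + 1 ↔ d < i := by omega
        simp [hI d, this]
  · intro s' hf hI
    refine ⟨(hf.real 3 rfl).trans h3, fun d => ?_⟩
    rw [hI d]
    by_cases hd' : Enters I.tail I.head d (side I s)
    · simp [hd', I.lt_of_enters hd']
    · simp [hd']

/-- That all smaller uncrossed cuts are covered is what the greedy condition on strict subsets asks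
of the current cut. -/
theorem ok_round (h : GreedyState I R s) (hn : n ≤ N) (hm : m ≤ N) (hk : k + k ≤ N)
    (hex : ∀ A ∈ I.twoCuts, ∃ d, Enters I.tail I.head d A)
    (hss : ∀ A ∈ I.uncrossedCuts R, A.card < s.nat 21 0 → Covered I s A) :
    round.Ok N s fun s' => GreedyState I R s' ∧ (∀ A, Covered I s A → Covered I s' A) ∧
      (I.graph.separated I.root (s.nat 22 0) (s.nat 23 0) ∈ I.uncrossedCuts R →
        (I.graph.separated I.root (s.nat 22 0) (s.nat 23 0)).card = s.nat 21 0 →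
        Covered I s' (I.graph.separated I.root (s.nat 22 0) (s.nat 23 0))) := by
  set A := I.graph.separated I.root (s.nat 22 0) (s.nat 23 0) with hA
  refine ok_seq' (ok_labels h.holds hn hm) fun s₁ hf₁ hside₁ => ?_
  rw [← hA] at hside₁
  have hs₁ : Same s s₁ := hf₁.same (by decide) rfl rfl
  refine ok_seq' (ok_size (h.holds.same hs₁) hn) fun s₂ hf₂ hsize₂ => ?_
  have hs₂ : Same s s₂ := hs₁.trans (hf₂.same (by decide) rfl rfl)
  have hside₂ : side I s₂ = A := (side_congr (hf₂.nat 7 rfl)).trans hside₁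
  refine ok_seq' (ok_crossed (h.holds.same hs₂) (by omega)) fun s₃ hf₃ hcr₃ => ?_
  have hs₃ : Same s s₃ := hs₂.trans (hf₃.same (by decide) rfl rfl)
  have hside₃ : side I s₃ = A := (side_congr (hf₃.nat 7 rfl)).trans hside₂
  refine ok_seq' (ok_covered (h.same hs₃) hk) fun s₄ hf₄ hcov₄ => ?_
  have hs₄ : Same s s₄ := hs₃.trans (hf₄.same (by decide) rfl rfl)
  have hside₄ : side I s₄ = A := (side_congr (hf₄.nat 7 rfl)).trans hside₃
  rw [covered_same hs₃, hside₃] at hcov₄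
  have hcr : s₄.nat 31 0 = 0 ↔ ∀ ℓ ∈ R, ℓ ∉ I.links.boundary A := by
    rw [hf₄.nat 31 rfl, hcr₃, hside₂]
  have hsize : s₄.nat 30 0 = A.card := by
    rw [hf₄.nat 30 rfl, hf₃.nat 30 rfl, hsize₂, hside₁]
  have hvar : ∀ a ∈ [21, 22, 23], s₄.nat a 0 = s.nat a 0 := by
    intro a ha
    rw [hf₄.nat a (by revert a; decide), hf₃.nat a (by revert a; decide),
      hf₂.nat a (by revert a; decide), hf₁.nat a (by revert a; decide)]
  have h21 := hvar 21 (by decide)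
  have h22 := hvar 22 (by decide)
  have h23 := hvar 23 (by decide)
  refine ok_ite (fun hb => ?_) fun hb => ok_skip ?_ <;>
    simp only [Test.Holds, Test.holds_natEq, NatExpr.eval, NatExpr.eval_var, hcov₄, hcr, hsize,
      h21] at hb
  swap
  · refine ⟨h.same hs₄, fun B => (covered_same hs₄).2, fun hU hcard => ?_⟩
    rw [covered_same hs₄]
    by_contra hnc
    refine hb ⟨hnc, hcard, (CacAP.mem_uncrossedCuts.1 hU).2, ?_⟩
    exact Finset.card_pos.2 (CacAP.nonempty_of_mem_twoCuts (CacAP.uncrossedCuts_subset _ _ hU))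
  obtain ⟨hnc, hcard, hcross, hpos⟩ := hb
  have hAU : A ∈ I.uncrossedCuts R := CacAP.mem_uncrossedCuts.2 ⟨CacAP.mem_twoCuts.2
    ⟨Multigraph.notMem_separated, I.isCactus.card_boundary_separated (Finset.card_pos.1 hpos)⟩,
    hcross⟩
  have h₄ := h.same hs₄
  refine ok_seq' (ok_cheapest h₄.holds h₄.directed hk
    (hside₄ ▸ hex A (CacAP.uncrossedCuts_subset _ _ hAU))) fun s₅ hf₅ hmin => ?_
  have hs₅ : Same s s₅ := hs₄.trans (hf₅.same (by decide) rfl rfl)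
  have h₅ := h.same hs₅
  have hside₅ : side I s₅ = A := (side_congr (hf₅.nat 7 rfl)).trans hside₄
  rw [hside₄, hs₄.real_one] at hmin
  refine ok_seq' (ok_raise h₅.holds h₅.directed hk) fun s₆ hf₆ hres => ?_
  set q := s.nat 20 0 with hq
  set b := s₅.nat 27 0 with hb
  have hq₅ : s₅.nat 20 0 = q := congrFun (hs₅.nat 20 (by decide)) 0
  rw [hside₅, hs₅.real_one, hs₅.real_three, hq₅] at hres
  have hmain : ∀ a ∈ mainArrays, s₆.nat a = s.nat a := fun a ha => by
    rw [hf₆.nat a (by revert a; decide), hs₅.nat a ha]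
  have hq₆ : s₆.nat 20 0 = q := congrFun (hmain 20 (by decide)) 0
  have hb₆ : s₆.nat 27 0 = b := congrFun (hf₆.nat 27 rfl) 0
  have he₆ : s₆.nat 22 0 = s.nat 22 0 := by rw [hf₆.nat 22 rfl, hf₅.nat 22 rfl, h22]
  have hf₆ : s₆.nat 23 0 = s.nat 23 0 := by rw [hf₆.nat 23 rfl, hf₅.nat 23 rfl, h23]
  refine ok_seq (ok_setNat (ok_seq (ok_setNat (ok_seq (ok_setNat (ok_setNat ?_))))))
  set s₇ := (((s₆.setNat 14 _ _).setNat 15 _ _).setNat 16 _ _).setNat 20 _ _ with hs₇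
  have h14 : s₇.nat 14 = Function.update (s.nat 14) q (s.nat 22 0) := by
    simp [hs₇, NatExpr.eval, hq₆, he₆, hmain 14 (by decide)]
  have h15 : s₇.nat 15 = Function.update (s.nat 15) q (s.nat 23 0) := by
    simp [hs₇, NatExpr.eval, hq₆, hf₆, hmain 15 (by decide)]
  have h16 : s₇.nat 16 = Function.update (s.nat 16) q b := by
    simp [hs₇, NatExpr.eval, hq₆, hb₆, hmain 16 (by decide)]
  have h20 : s₇.nat 20 0 = q + 1 := by
    simp [hs₇, NatExpr.eval, hq₆]
  have hcut : ∀ i < q, cutAt I s₇ i = cutAt I s i := by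
    intro i hi
    simp [cutAt, h14, h15, Function.update_of_ne hi.ne]
  have hcutq : cutAt I s₇ q = A := by simp [cutAt, h14, h15, hA]
  have hcov : ∀ B, Covered I s B → Covered I s₇ B := by
    rintro B ⟨i, hi, hB⟩
    exact ⟨i, by omega, by rwa [h16, Function.update_of_ne hi.ne]⟩
  refine ⟨⟨?_, ?_, ?_⟩, hcov, fun _ _ => ⟨q, by omega, by simpa [h16] using hmin.1⟩⟩
  · refine h.holds.congr fun a ha => ?_
    rw [← hmain a (by revert a; decide)]
    simp only [hs₇]
    iterate 4 rw [State.setNat_nat_of_ne _ _ _ (by omega)]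
  · refine h.directed.congr ?_ ?_ ?_
    · simp [hs₇, hmain 10 (by decide)]
    · simp [hs₇, hmain 11 (by decide)]
    · simp [hs₇, hmain 12 (by decide)]
  · rw [h20]
    refine h.greedy.succ hcut (fun i hi => ?_) (fun i hi => ?_) (hcutq ▸ hAU) ?_ ?_ ?_ ?_ ?_ ?_
    · rw [h16, Function.update_of_ne hi.ne]
    · change s₆.real 3 i = _
      rw [hres.1, Function.update_of_ne hi.ne]
    · rw [hcutq]
      exact fun j hj hjA => hnc ⟨j, hj, hjA⟩
    · rw [hcutq]
      exact fun B hB hBA => hss B hB (hcard ▸ Finset.card_lt_card hBA)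
    · rw [hcutq, h16, Function.update_self]
      exact hmin.1
    · change s₆.real 3 q = _
      rw [hres.1, h16, Function.update_self, Function.update_self]
    · rw [hcutq, h16, Function.update_self]
      exact hmin.2
    · intro d
      change s₆.real 1 d = if _ then s.real 1 d - s₆.real 3 q else _
      rw [hres.2, hres.1, hcutq, Function.update_self]

/-- Coverage is never lost, so the three nested invariants record the sizes, the first edges and the
second edges already exhausted. -/
theorem ok_greedy (h : GreedyState I R s) (hn : n + 1 ≤ N) (hm : m ≤ N) (hk : k + k ≤ N)
    (hex : ∀ A ∈ I.twoCuts, ∃ d, Enters I.tail I.head d A) :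
    greedy.Ok N s fun s' => GreedyState I R s' ∧ ∀ A ∈ I.uncrossedCuts R, Covered I s' A := by
  have hset : ∀ {s' : State} {A : Finset (Fin n)} (a i x : ℕ), a ∉ mainArrays →
      (Covered I (s'.setNat a i x) A ↔ Covered I s' A) :=
    fun a i x ha => covered_same (same_setNat ha i x)
  refine Prog.Ok.mono' (ok_forTo (M := n + 1) (fun i s' => GreedyState I R s' ∧
    ∀ A ∈ I.uncrossedCuts R, A.card < i → Covered I s' A) hn rfl ?_ ?_ ?_) ?_
  · intro s' hf
    simp [NatExpr.eval, numV, (h.holds.frame hf (by decide)).numV]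
  · exact ⟨h.same (same_setNat (by decide) _ _), by simp⟩
  · rintro c hc s₁ - hc₁ ⟨h₁, hcov₁⟩
    refine Prog.Ok.mono' (ok_forTo (M := m) (fun e s' => GreedyState I R s' ∧
      (∀ A ∈ I.uncrossedCuts R, A.card < c → Covered I s' A) ∧
      ∀ e' < e, ∀ f < m, I.graph.separated I.root e' f ∈ I.uncrossedCuts R →
        (I.graph.separated I.root e' f).card = c →
        Covered I s' (I.graph.separated I.root e' f)) hm rfl ?_ ?_ ?_) ?_
    · exact fun s' hf => (h₁.holds.frame hf (by decide)).numE
    · refine ⟨h₁.same (same_setNat (by decide) _ _), fun A hA hAc => ?_, by simp⟩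
      exact (hset _ _ _ (by decide)).2 (hcov₁ A hA hAc)
    · rintro e he s₂ hf₂ he₂ ⟨h₂, hcov₂, hpair₂⟩
      have hc₂ : s₂.nat 21 0 = c := by rw [hf₂.nat 21 rfl, hc₁]
      refine Prog.Ok.mono' (ok_forTo (M := m) (fun f s' => GreedyState I R s' ∧
        (∀ A, Covered I s₂ A → Covered I s' A) ∧
        ∀ f' < f, I.graph.separated I.root e f' ∈ I.uncrossedCuts R →
          (I.graph.separated I.root e f').card = c →
          Covered I s' (I.graph.separated I.root e f')) hm rfl ?_ ?_ ?_) ?_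
      · exact fun s' hf => (h₂.holds.frame hf (by decide)).numE
      · exact ⟨h₂.same (same_setNat (by decide) _ _),
          fun A hA => (hset _ _ _ (by decide)).2 hA, by simp⟩
      · rintro f hf s₃ hf₃ hff₃ ⟨h₃, hcov₃, hpair₃⟩
        have hc₃ : s₃.nat 21 0 = c := by rw [hf₃.nat 21 rfl, hc₂]
        have he₃ : s₃.nat 22 0 = e := by rw [hf₃.nat 22 rfl, he₂]
        refine Prog.Ok.mono' (ok_round h₃ (by omega) hm hk hex
          fun A hA hAc => hcov₃ A (hcov₂ A hA (hc₃ ▸ hAc))) ?_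
        rintro s₄ - ⟨h₄, hcov₄, hpair₄⟩
        rw [hc₃, he₃, hff₃] at hpair₄
        refine ⟨h₄.same (same_setNat (by decide) _ _), fun A hA => ?_, fun f' hf' hU hcard => ?_⟩
        · exact (hset _ _ _ (by decide)).2 (hcov₄ A (hcov₃ A hA))
        · refine (hset _ _ _ (by decide)).2 ?_
          rcases Nat.lt_succ_iff_lt_or_eq.1 hf' with hf' | rfl
          · exact hcov₄ _ (hpair₃ f' hf' hU hcard)
          · exact hpair₄ hU hcard
      · rintro s₃ - ⟨h₃, hcov₃, hpair₃⟩
        refine ⟨h₃.same (same_setNat (by decide) _ _), fun A hA hAc => ?_,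
          fun e' he' f hf hU hcard => ?_⟩
        · exact (hset _ _ _ (by decide)).2 (hcov₃ A (hcov₂ A hA hAc))
        · refine (hset _ _ _ (by decide)).2 ?_
          rcases Nat.lt_succ_iff_lt_or_eq.1 he' with he' | rfl
          · exact hcov₃ _ (hpair₂ e' he' f hf hU hcard)
          · exact hpair₃ f hf hU hcard
    · rintro s₂ - ⟨h₂, hcov₂, hpair₂⟩
      refine ⟨h₂.same (same_setNat (by decide) _ _), fun A hA hAc => ?_⟩
      refine (hset _ _ _ (by decide)).2 ?_
      rcases Nat.lt_succ_iff_lt_or_eq.1 hAc with hAc | hAc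
      · exact hcov₂ A hA hAc
      · obtain ⟨hr, h2⟩ := CacAP.mem_twoCuts.1 (CacAP.uncrossedCuts_subset _ _ hA)
        -- Every cut of the current size has been met, since it is separated by some pair of edges.
        obtain ⟨e, he, f, hf, rfl⟩ := I.isCactus.exists_separated_eq hr h2
        exact hpair₂ e he f hf hA hAc
  · rintro s' - ⟨h', hcov'⟩
    refine ⟨h', fun A hA => hcov' A hA ?_⟩
    have := Finset.card_le_univ A
    rw [Fintype.card_fin] at this
    omega

/-! ### The selection phase -/

/-- The memory content after the rounds `q - j, …, q - 1` of the greedy phase have been considered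
for selection. -/
structure IsSelection (I : CacAP (Fin n) (Fin m) (Fin k)) (q : ℕ) (C : ℕ → Finset (Fin n))
    (e : ℕ → ℕ) (j : ℕ) (s : State) : Prop where
  eq_zero : ∀ i < q - j, s.nat 17 i = 0
  selects : ∀ i < q, q - j ≤ i → (s.nat 17 i ≠ 0 ↔
    ∀ i', i < i' → i' < q → s.nat 17 i' ≠ 0 → ¬ Enters I.tail I.head (e i') (C i))
  output : ∀ ℓ, s.nat 6 ℓ ≠ 0 ↔
    ∃ i < q, s.nat 17 i ≠ 0 ∧ (if e i < k then e i else e i - k) = ℓ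

theorem ok_select (h : GreedyState I R s) (hn : n ≤ N) (hm : m ≤ N) (hk : k + k ≤ N)
    (h6 : s.nat 6 = fun _ => 0) (h17 : s.nat 17 = fun _ => 0) :
    select.Ok N s fun s' =>
      IsSelection I (s.nat 20 0) (cutAt I s) (s.nat 16) (s.nat 20 0) s' := by
  set q := s.nat 20 0 with hq
  refine ok_forTo (fun j s' => IsSelection I q (cutAt I s) (s.nat 16) j s') (h.le.trans hk)
    rfl ?_ ?_ ?_
  · intro s' hf
    rw [NatExpr.eval_var, hf.nat 20 rfl]
  · refine ⟨?_, fun i hi hi' => absurd hi (by omega), ?_⟩ <;> simp [h6, h17]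
  intro j hj s₁ hf₁ hj₁ hI
  have hs₁ : Same s s₁ := hf₁.same (by decide) rfl rfl
  refine ok_seq (ok_setNat (ok_seq (ok_setNat (ok_seq (ok_setNat ?_)))))
  -- Step `j` of this loop treats round `q - 1 - j`, so all later rounds have been decided and all
  -- entries of array `17` up to `i` are still zero.
  set i := q - 1 - j with hi
  have hiq : i < q := by omega
  have hij : q - j = i + 1 := by omega
  have hij' : q - (j + 1) = i := by omega
  set s₂ := ((s₁.setNat 26 _ _).setNat 22 _ _).setNat 23 _ _ with hs₂def
  have hs₂ : Same s s₂ := ((hs₁.trans (same_setNat (by decide) _ _)).trans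
    (same_setNat (by decide) _ _)).trans (same_setNat (by decide) _ _)
  have h20 : s₁.nat 20 0 = q := congrFun (hs₁.nat 20 (by decide)) 0
  have h14 : s₁.nat 14 = s.nat 14 := hs₁.nat 14 (by decide)
  have h15 : s₁.nat 15 = s.nat 15 := hs₁.nat 15 (by decide)
  have h26 : s₂.nat 26 0 = i := by
    simp [hs₂def, NatExpr.eval, h20, hj₁, hi]
  have h22 : s₂.nat 22 0 = s.nat 14 i := by
    simp [hs₂def, NatExpr.eval, h20, hj₁, hi, h14]
  have h23 : s₂.nat 23 0 = s.nat 15 i := by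
    simp [hs₂def, NatExpr.eval, h20, hj₁, hi, h15]
  have h17₂ : s₂.nat 17 = s₁.nat 17 := by simp [hs₂def]
  have h6₂ : s₂.nat 6 = s₁.nat 6 := by simp [hs₂def]
  refine ok_seq' (ok_labels (h.holds.same hs₂) hn hm) fun s₃ hf₃ hside₃ => ?_
  have hs₃ : Same s s₃ := hs₂.trans (hf₃.same (by decide) rfl rfl)
  rw [h22, h23] at hside₃
  change side I s₃ = cutAt I s i at hside₃
  have h17₃ : s₃.nat 17 = s₁.nat 17 := (hf₃.nat 17 rfl).trans h17₂
  refine ok_seq' (ok_anyTo (fun i' => s₁.nat 17 i' ≠ 0 ∧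
    Enters I.tail I.head (s.nat 16 i') (cutAt I s i)) (h.le.trans hk) (by norm_num) ?_ ?_) ?_
  · intro s₄ hf₄
    rw [NatExpr.eval_var, hf₄.nat 20 rfl, hs₃.nat 20 (by decide)]
  · intro i' hi' s₄ hf₄ hc₄
    have hs₄ : Same s s₄ := hs₃.trans (hf₄.same (by decide) rfl rfl)
    rw [Test.Holds, holds_entersT (h.holds.same hs₄) (h.directed.same hs₄) (d := s.nat 16 i') ?_
      (h.lt hi'), side_congr (hf₄.nat 7 rfl), hside₃]
    · simp [Test.Holds, NatExpr.eval, hc₄, hf₄.nat 17 rfl, h17₃]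
    · rw [NatExpr.eval, NatExpr.eval_var, hc₄, hs₄.nat 16 (by decide)]
  intro s₄ hf₄ hcov
  have hs₄ : Same s s₄ := hs₃.trans (hf₄.same (by decide) rfl rfl)
  have h17₄ : s₄.nat 17 = s₁.nat 17 := (hf₄.nat 17 rfl).trans h17₃
  have h6₄ : s₄.nat 6 = s₁.nat 6 := ((hf₄.nat 6 rfl).trans (hf₃.nat 6 rfl)).trans h6₂
  have h26₄ : s₄.nat 26 0 = i := by rw [hf₄.nat 26 rfl, hf₃.nat 26 rfl, h26]
  have hzero : ∀ i' ≤ i, s₁.nat 17 i' = 0 := fun i' hi' => hI.eq_zero i' (by omega)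
  refine ok_ite (fun hb => ok_seq (ok_setNat (ok_setNat ?_))) fun hb => ok_skip ?_ <;>
    simp only [Test.holds_natEq, NatExpr.eval_var, NatExpr.eval, hcov] at hb
  · set s₅ := ((s₄.setNat 17 _ _).setNat 6 _ _).setNat 21 _ _ with hs₅
    have h17₅ : s₅.nat 17 = Function.update (s₁.nat 17) i 1 := by
      simp [hs₅, NatExpr.eval, h17₄, h26₄]
    have h6₅ : s₅.nat 6 = Function.update (s₁.nat 6)
        (if s.nat 16 i < k then s.nat 16 i else s.nat 16 i - k) 1 := by
      have h12 := (h.directed.same hs₄ _ (h.lt hiq)).2.2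
      simp [hs₅, NatExpr.eval, h6₄, h26₄, hs₄.nat 16 (by decide), h12]
    refine ⟨fun i' hi' => ?_, fun i' hi' hle => ?_, fun ℓ => ?_⟩
    · rw [h17₅, Function.update_of_ne (by omega)]
      exact hzero i' (by omega)
    · rw [h17₅]
      rcases (show i ≤ i' by omega).eq_or_lt with rfl | hlt
      · simp only [Function.update_self, ne_eq, one_ne_zero, not_false_eq_true, true_iff]
        intro l hl hlq hsl
        rw [Function.update_of_ne hl.ne'] at hsl
        exact fun hen => hb l hlq ⟨hsl, hen⟩
      · rw [Function.update_of_ne hlt.ne', hI.selects i' hi' (by omega)]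
        refine forall_congr' fun l => forall_congr' fun hl => ?_
        rw [Function.update_of_ne (by omega)]
    · rw [h6₅, h17₅]
      by_cases hℓ : (if s.nat 16 i < k then s.nat 16 i else s.nat 16 i - k) = ℓ
      · rw [hℓ, Function.update_self]
        simp only [ne_eq, one_ne_zero, not_false_eq_true, true_iff]
        exact ⟨i, hiq, by simp, hℓ⟩
      · rw [Function.update_of_ne (Ne.symm hℓ), hI.output]
        refine exists_congr fun l => and_congr_right fun _ => ?_
        by_cases hl : l = i
        · subst hl
          simp [hℓ]
        · rw [Function.update_of_ne hl]
  · have h17₅ : (s₄.setNat 21 0 (j + 1)).nat 17 = s₁.nat 17 := by simp [h17₄]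
    have h6₅ : (s₄.setNat 21 0 (j + 1)).nat 6 = s₁.nat 6 := by simp [h6₄]
    refine ⟨fun i' hi' => ?_, fun i' hi' hle => ?_, fun ℓ => ?_⟩
    · rw [h17₅]
      exact hzero i' (by omega)
    · rw [h17₅]
      rcases (show i ≤ i' by omega).eq_or_lt with rfl | hlt
      · simp only [hzero _ le_rfl, ne_eq, not_true_eq_false, false_iff]
        intro hall
        refine hb fun l hl hsl => ?_
        refine hall l ?_ hl hsl.1 hsl.2
        by_contra hle'
        exact hsl.1 (hzero l (by omega))
      · exact hI.selects i' hi' (by omega)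
    · rw [h17₅, h6₅]
      exact hI.output ℓ

/-! ### The algorithm -/

theorem ok_algorithm (hn : n + 1 ≤ N) (hm : m ≤ N) (hk : k + k ≤ N)
    (hex : ∀ A ∈ I.twoCuts, ∃ d, Enters I.tail I.head d A) :
    algorithm.Ok N (I.input R) fun s' => ∃ (q : ℕ) (C : ℕ → Finset (Fin n)) (e : ℕ → ℕ)
      (val res : ℕ → ℝ) (sel : ℕ → Prop),
      IsGreedy I.tail I.head I.dcost (I.uncrossedCuts R) q C e val res ∧
      (∀ A ∈ I.uncrossedCuts R, ∃ i < q, Enters I.tail I.head (e i) A) ∧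
      IsGreedy.Selects I.tail I.head q C e sel ∧
      ∀ ℓ : Fin k, ℓ ∈ s'.output k ↔
        ∃ i < q, sel i ∧ (if e i < k then e i else e i - k) = ℓ := by
  have h₀ : Holds I R (I.input R) := holds_input
  refine ok_seq' (ok_initDirected h₀ (by omega) rfl fun ℓ => by simp [CacAP.input, pad]) ?_
  rintro s₁ hf₁ ⟨hd₁, hr₁⟩
  have hg₁ : GreedyState I R s₁ := by
    refine ⟨h₀.frame hf₁ (by decide), hd₁, ?_⟩
    have hq : s₁.nat 20 0 = 0 := congrFun (hf₁.nat 20 rfl) 0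
    rw [hq, hr₁]
    exact IsGreedy.zero I.dcost_nonneg _ _ _
  refine ok_seq' (ok_greedy hg₁ hn hm hk hex) ?_
  rintro s₂ hf₂ ⟨hg₂, hcov₂⟩
  refine Prog.Ok.mono' (ok_select hg₂ (by omega) hm hk ?_ ?_) ?_
  · rw [hf₂.nat 6 rfl, hf₁.nat 6 rfl]
    rfl
  · rw [hf₂.nat 17 rfl, hf₁.nat 17 rfl]
    rfl
  · intro s₃ _ hsel
    refine ⟨_, _, _, _, _, fun i => s₃.nat 17 i ≠ 0, hg₂.greedy, hcov₂,
      fun i hi => hsel.selects i hi (by omega), fun ℓ => ?_⟩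
    rw [State.output, Finset.mem_filter, hsel.output]
    simp

end RAM

/-! ### Feasibility and the main theorem -/

open Classical in
theorem CacAP.Feasible.exists_enters {V E : Type*} [Fintype V] [Fintype E] {k : ℕ}
    {I : CacAP V E (Fin k)} (h : I.Feasible) :
    ∀ A ∈ I.twoCuts, ∃ d, Enters I.tail I.head d A := by
  intro A hA
  obtain ⟨F, hF⟩ := h
  obtain ⟨ℓ, -, hℓ⟩ := (I.isSolution_iff F).1 hF A hA
  obtain ⟨u, v, hj, hu, hv⟩ := I.mem_boundary_links_iff.1 hℓ
  obtain ⟨d, rfl, rfl, -⟩ := I.exists_directed hj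
  exact ⟨d, hu, hv⟩

theorem mainTheorem9 :
    ∃ (P : RAM.Prog) (p : Polynomial ℕ),
      ∀ (n m k : ℕ) (I : CacAP (Fin n) (Fin m) (Fin k)), I.Feasible →
        (∃ y, I.IsMinimalLaminarOptimum y) ∧
        ∀ R : Finset (Fin k), R ⊆ I.crossLinks →
          ∃ (t : ℕ) (s : RAM.State),
            P.Run (I.input R) t s ∧ t ≤ p.eval (n + m + k) ∧
            I.IsSolution (R ∪ s.output k) ∧
            ∀ y, I.IsMinimalLaminarOptimum y →
              ∑ ℓ ∈ s.output k, I.cost ℓ ≤ ∑ C ∈ I.uncrossedCuts R, y C := by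
  classical
  obtain ⟨p, hp⟩ := RAM.algorithm.exists_polynomial_time
  refine ⟨RAM.algorithm, p.comp (2 * Polynomial.X + 1), fun n m k I hI => ⟨?_, fun R hR => ?_⟩⟩
  -- Existence of the optimum comes from the run with `R = ∅`. The value of `N` dominates all loop
  -- bounds `n + 1`, `n`, `m`, `k` and `2 k`.
  · obtain ⟨-, -, -, -, q, C, e, val, res, sel, h, hcov, hs, -⟩ :=
      RAM.ok_algorithm (I := I) (R := ∅) (N := 2 * (n + m + k) + 1) (by omega) (by omega)
        (by omega) (fun A hA => by convert hI.exists_enters A hA)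
    rw [CacAP.uncrossedCuts_empty] at h hcov
    exact ⟨_, h.isMinimalLaminarOptimum hcov hs⟩
  · obtain ⟨t, s, hrun, ht, q, C, e, val, res, sel, h, hcov, hs, hout⟩ :=
      RAM.ok_algorithm (I := I) (R := R) (N := 2 * (n + m + k) + 1) (by omega) (by omega)
        (by omega) (fun A hA => by convert hI.exists_enters A hA)
    have hU := I.isIntersecting_uncrossedCuts R
    refine ⟨t, s, hrun, by simpa [← hp] using ht, ?_, fun y hy => ?_⟩
    · rw [CacAP.isSolution_iff]
      intro A hA
      by_cases hAR : A ∈ I.uncrossedCuts R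
      · obtain ⟨i, hi, hsi, hen⟩ := hs.cover h hU hcov A hAR
        obtain ⟨ℓ, hℓ, hj, -⟩ := I.joins_directed (I.lt_of_enters hen)
        exact ⟨ℓ, Finset.mem_union_right _ ((hout ℓ).2 ⟨i, hi, hsi, hℓ.symm⟩),
          I.mem_boundary_links_iff.2 ⟨_, _, hj, hen⟩⟩
      · rw [CacAP.mem_uncrossedCuts] at hAR
        push Not at hAR
        obtain ⟨ℓ, hℓ, hℓA⟩ := hAR hA
        exact ⟨ℓ, Finset.mem_union_left _ hℓ, hℓA⟩
    · refine le_trans ?_ ((hs.sum_cost_le h hU).trans (h.sum_val_le hR hy))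
      -- Each output link is charged to one selected round that produced it. Both orientations of a
      -- link may be selected, so the rounds charged need not exhaust the selected ones, and
      -- nonnegativity of the costs is used.
      choose! g hg using fun ℓ hℓ => (hout ℓ).1 hℓ
      have hcost : ∀ ℓ ∈ s.output k, I.dcost (e (g ℓ)) = I.cost ℓ := by
        intro ℓ hℓ
        rw [CacAP.dcost, (hg ℓ hℓ).2.2]
        simp [RAM.pad]
      have hinj : Set.InjOn g (s.output k) := by
        intro ℓ hℓ ℓ' hℓ' heq
        have h₁ := (hg ℓ hℓ).2.2
        rw [heq, (hg ℓ' hℓ').2.2] at h₁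
        exact (Fin.ext h₁).symm
      rw [← Finset.sum_congr rfl hcost, ← Finset.sum_image (f := fun i => I.dcost (e i)) hinj]
      refine Finset.sum_le_sum_of_subset_of_nonneg (fun i hi => ?_)
        fun _ _ _ => I.dcost_nonneg _
      obtain ⟨ℓ, hℓ, rfl⟩ := Finset.mem_image.1 hi
      exact Finset.mem_filter.2 ⟨Finset.mem_range.2 (hg ℓ hℓ).1, (hg ℓ hℓ).2.1⟩
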